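/- **Notation.** For a set $\Lambda$, order the finite sequences in $\Lambda$ by $s\preceq t$ iff $s$ is an initial segment of $t$, and write $s\prec t$ if moreover $s\neq t$. For a set $S$ of finite sequences, $MAX(S)$ is the set of its $\preceq$-maximal members and $\Pi S=\{(s,t)\in S\times S: s\preceq t\in MAX(S)\}$. For an ordinal $\zeta$, $\zeta+(\zeta_i)_{i=1}^k=(\zeta+\zeta_i)_{i=1}^k$ and $\zeta+S=\{\zeta+s:s\in S\}$; $s^\frown t$ is concatenation. *Trees.* Put $\Gamma_0=\{(0)\}$. Given $\Gamma_\xi$, put $\Gamma_{\xi,1}=\Gamma_\xi$ and, for $n\geq 1$, $$\Gamma_{\xi,n+1}=(\omega^\xi n+\Gamma_\xi)\cup\{t^\frown u: t\in MAX(\omega^\xi n+\Gamma_\xi),\ u\in\Gamma_{\xi,n}\},\qquad \Gamma_{\xi+1}=\bigcup_{n\geq 1}\Gamma_{\xi,n}.$$ If $\xi$ is a limit ordinal, $\Gamma_\xi=\bigcup_{\zeta<\xi}(\omega^\zeta+\Gamma_{\zeta+1})$. These unions are disjoint. Fix a directed set $D$. For a set $S$ of sequences, $SD$ is the set of sequences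 $(\zeta_i,U_i)_{i=1}^k$ with $(\zeta_i)_{i=1}^k\in S$ and $U_i\in D$; let $\Omega_\xi=\Gamma_\xi D$. *Weights.* For $t\in\Gamma_{\xi,n}$, let $\iota_{\xi,n}(t)\in\Gamma_\xi$ be obtained by writing $t=t_1{}^\frown\cdots{}^\frown t_{m-1}{}^\frown(\omega^\xi(n-m)+u)$ with $1\le m\le n$, $t_j\in MAX(\omega^\xi(n-j)+\Gamma_\xi)$ and $u\in\Gamma_\xi$ (this is unique), and setting $\iota_{\xi,n}(t)=u$. Define $\mathbb P_\xi$ on $\Gamma_\xi$ by $\mathbb P_0((0))=1$; $\mathbb P_{\xi+1}(t)=\frac1n\mathbb P_\xi(\iota_{\xi,n}(t))$ for $t\in\Gamma_{\xi,n}$; and, for a limit ordinal $\xi$, $\mathbb P_\xi(\omega^\zeta+t)=\mathbb P_{\zeta+1}(t)$ for $\zeta<\xi$ and $t\in\Gamma_{\zeta+1}$. On $\Omega_\xi$ let $\mathbb P_\xi((\zeta_i,U_i)_{i=1}^k)=\mathbb P_\xi((\zeta_i)_{i=1}^k)$. *Large functions.* An extended pruning $(\theta,e):\Omega_\xi\to\Omega_\xi$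 consists of a map $\theta:\Omega_\xi\to\Omega_\xi$ with $\theta(s)\prec\theta(s')$ whenever $s\prec s'$, and with $U\leq_D U'$ whenever $(\zeta,U)$ is the last term of $s$ and $(\zeta',U')$ is the last term of $\theta(s)$, together with a map $e:MAX(\Omega_\xi)\to MAX(\Omega_\xi)$ with $\theta(t)\preceq e(t)$ for all $t\in MAX(\Omega_\xi)$. For $\varepsilon\in\mathbb R$, a bounded $f:\Pi\Omega_\xi\to\mathbb R$ is $\varepsilon$-large if for every $\delta>0$ there is an extended pruning $(\theta,e):\Omega_\xi\to\Omega_\xi$ with $f(\theta(s),e(t))\geq\varepsilon-\delta$ for all $(s,t)\in\Pi\Omega_\xi$. **Theorem (Simultaneity theorem).** Let $\xi$ be an ordinal, $D$ a directed set, $n\geq 1$ a natural number, and let $\mathcal F_1,\dots,\mathcal F_n$ be collections of bounded functions from $\Pi\Omega_\xi$ into $\mathbb R$. Suppose $\varepsilon_1,\dots,\varepsilon_n\in\mathbb R$ are such that for each $1\leq i\leq n$, no member of $\mathcal F_i$ is $\varepsilon_i$-large. Then for any $f_1\in\mathcal F_1,\dots,f_n\in\mathcal F_n$, $$\inf_{t\in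 MAX(\Omega_\xi)}\ \max_{1\leq i\leq n}\Bigl[\sum_{s\preceq t}\mathbb P_\xi(s)f_i(s,t)-\varepsilon_i\Bigr]\leq 0,$$ where the infimum is that of a nonempty set of reals which is bounded below, and the sum is over the $s\in\Omega_\xi$ with $s\preceq t$. -/

import Mathlib

open Order
open scoped Ordinal

universe u v

namespace BTree

/-! Finite sequences in a set `Λ` are lists; `s <+: t` says that `s` is an initial segment of `t`. -/

/-- `s ≺ t`: `s` is a proper initial segment of `t`. -/
def Prec {Λ : Type*} (s t : List Λ) : Prop := s <+: t ∧ s ≠ t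

/-- `MAX S`: the members of `S` which are maximal for the initial segment order. -/
def maxSet {Λ : Type*} (S : Set (List Λ)) : Set (List Λ) :=
  {t | t ∈ S ∧ ∀ s ∈ S, ¬ Prec t s}

/-- `Π S = {(s, t) ∈ S × S : s ≼ t ∈ MAX S}`. -/
def piSet {Λ : Type*} (S : Set (List Λ)) : Set (List Λ × List Λ) :=
  {p | p.1 ∈ S ∧ p.2 ∈ maxSet S ∧ p.1 <+: p.2}

/-- `ζ + (ζ₁, …, ζₖ) = (ζ + ζ₁, …, ζ + ζₖ)`. -/
def shift (ζ : Ordinal.{u}) (t : List Ordinal.{u}) : List Ordinal.{u} :=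
  t.map (fun α => ζ + α)

/-- The sets `Γ_{ξ,n}`, given `o = ω ^ ξ` and `G = Γ_ξ`:
`Γ_{ξ,n+1} = (ω ^ ξ * n + Γ_ξ) ∪ {t ⌢ u : t ∈ MAX (ω ^ ξ * n + Γ_ξ), u ∈ Γ_{ξ,n}}`, started at the
empty set for `n = 0`, which makes `Γ_{ξ,1} = Γ_ξ` (see `gammaN_one`). -/
def gammaN (o : Ordinal.{u}) (G : Set (List Ordinal.{u})) : ℕ → Set (List Ordinal.{u})
  | 0 => ∅
  | n + 1 => shift (o * n) '' G ∪
      {w | ∃ t ∈ maxSet (shift (o * n) '' G), ∃ v ∈ gammaN o G n, w = t ++ v}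

/-- The trees `Γ_ξ`: `Γ_0 = {(0)}`, `Γ_{ξ+1} = ⋃ n, Γ_{ξ,n}`, and
`Γ_ξ = ⋃ ζ < ξ, (ω ^ ζ + Γ_{ζ+1})` for limit `ξ`. -/
noncomputable def gamma (ξ : Ordinal.{u}) : Set (List Ordinal.{u}) :=
  Ordinal.limitRecOn ξ {[0]} (fun ζ G => ⋃ n : ℕ, gammaN (ω ^ ζ) G n)
    (fun _ hξ G => {w | ∃ ζ, ∃ h : ζ < _, ∃ t ∈ G (ζ + 1) (hξ.add_one_lt h), w = shift (ω ^ ζ) t})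

/-- The graph of the map `ι_{ξ,n} : Γ_{ξ,n} → Γ_ξ`, given `o = ω ^ ξ` and `G = Γ_ξ`: it removes the
complete blocks which come before the last (possibly incomplete) block `ω ^ ξ * k + u` of a sequence
in `Γ_{ξ,n}`, and sends that block to `u`. -/
inductive UnitProj (o : Ordinal.{u}) (G : Set (List Ordinal.{u})) :
    ℕ → List Ordinal.{u} → List Ordinal.{u} → Prop
  | first {n : ℕ} {u : List Ordinal.{u}} (hu : u ∈ G) :
      UnitProj o G (n + 1) (shift (o * n) u) u
  | later {n : ℕ} {t w u : List Ordinal.{u}} (ht : t ∈ maxSet (shift (o * n) '' G))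
      (h : UnitProj o G n w u) : UnitProj o G (n + 1) (t ++ w) u

/-- The graph of `ℙ_ξ` on `Γ_ξ`: `ℙ_0 ((0)) = 1`, `ℙ_{ξ+1} (t) = ℙ_ξ (ι_{ξ,n} (t)) / n` for
`t ∈ Γ_{ξ,n}`, and `ℙ_ξ (ω ^ ζ + t) = ℙ_{ζ+1} (t)` for limit `ξ`, `ζ < ξ` and `t ∈ Γ_{ζ+1}`. -/
inductive IsWeight : Ordinal.{u} → List Ordinal.{u} → ℝ → Prop
  | zero : IsWeight 0 [0] 1
  | succ {ξ : Ordinal.{u}} {n : ℕ} {t w : List Ordinal.{u}} {p : ℝ}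
      (hw : UnitProj (ω ^ ξ) (gamma ξ) n t w) (hp : IsWeight ξ w p) :
      IsWeight (ξ + 1) t (1 / (n : ℝ) * p)
  | limit {ξ ζ : Ordinal.{u}} {t : List Ordinal.{u}} {p : ℝ} (hξ : IsSuccLimit ξ) (hζ : ζ < ξ)
      (ht : t ∈ gamma (ζ + 1)) (hp : IsWeight (ζ + 1) t p) :
      IsWeight ξ (shift (ω ^ ζ) t) p

/-! Basic facts which show that `ℙ_ξ` is well defined on `Γ_ξ`. -/

theorem gammaN_one (o : Ordinal.{u}) (G : Set (List Ordinal.{u})) : gammaN o G 1 = G := by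
  have h : shift (0 : Ordinal.{u}) = id := by
    funext t
    simp [shift]
  simp [gammaN, h]

theorem gamma_zero : gamma.{u} 0 = {[0]} := by
  simp [gamma]

theorem gamma_succ (ξ : Ordinal.{u}) :
    gamma (ξ + 1) = ⋃ n : ℕ, gammaN (ω ^ ξ) (gamma ξ) n := by
  simp [gamma, Ordinal.limitRecOn_add_one]

theorem gamma_limit {ξ : Ordinal.{u}} (hξ : IsSuccLimit ξ) :
    gamma ξ = {w | ∃ ζ < ξ, ∃ t ∈ gamma (ζ + 1), w = shift (ω ^ ζ) t} := by
  rw [gamma, Ordinal.limitRecOn_limit _ _ _ _ hξ]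
  ext w
  simp only [Set.mem_ofPred_eq, gamma, exists_prop]

/-- All terms of the sequences in `Γ_{ξ,n}` lie below `ω ^ ξ * n`, and these are nonempty. -/
theorem gammaN_bound {o : Ordinal.{u}} {G : Set (List Ordinal.{u})}
    (hG : ∀ t ∈ G, t ≠ [] ∧ ∀ α ∈ t, α < o) (n : ℕ) :
    ∀ t ∈ gammaN o G n, t ≠ [] ∧ ∀ α ∈ t, α < o * n := by
  induction n with
  | zero => intro t ht; exact absurd ht (by simp [gammaN])
  | succ n ih =>
    have key : ∀ t ∈ shift (o * n) '' G, t ≠ [] ∧ ∀ α ∈ t, α < o * ((n + 1 : ℕ) : Ordinal.{u}) := by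
      rintro _ ⟨t, ht, rfl⟩
      refine ⟨by simpa [shift] using (hG t ht).1, ?_⟩
      intro α hα
      obtain ⟨β, hβ, rfl⟩ := List.mem_map.1 hα
      rw [Nat.cast_succ, mul_add_one]
      gcongr
      exact (hG t ht).2 β hβ
    rintro w (hw | ⟨t, ht, v, hv, rfl⟩)
    · exact key w hw
    · refine ⟨by simp [(key t ht.1).1], ?_⟩
      intro α hα
      rcases List.mem_append.1 hα with h | h
      · exact (key t ht.1).2 α h
      · refine ((ih v hv).2 α h).trans_le ?_
        gcongr
        simp

theorem gamma_bound (ξ : Ordinal.{u}) : ∀ t ∈ gamma ξ, t ≠ [] ∧ ∀ α ∈ t, α < ω ^ ξ := by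
  induction ξ using Ordinal.limitRecOn with
  | zero => simp [gamma_zero]
  | add_one ξ ih =>
    intro t ht
    rw [gamma_succ, Set.mem_iUnion] at ht
    obtain ⟨n, hn⟩ := ht
    obtain ⟨h1, h2⟩ := gammaN_bound ih n t hn
    refine ⟨h1, fun α hα => (h2 α hα).trans ?_⟩
    rw [Ordinal.opow_add_one]
    gcongr
    · exact Ordinal.opow_pos _ Ordinal.omega0_pos
    · exact Ordinal.natCast_lt_omega0 n
  | limit ξ hξ ih =>
    intro t ht
    rw [gamma_limit hξ] at ht
    obtain ⟨ζ, hζ, s, hs, rfl⟩ := ht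
    obtain ⟨h1, h2⟩ := ih (ζ + 1) (hξ.add_one_lt hζ) s hs
    refine ⟨by simpa [shift] using h1, ?_⟩
    intro α hα
    obtain ⟨β, hβ, rfl⟩ := List.mem_map.1 hα
    exact Ordinal.isPrincipal_add_omega0_opow ξ
      ((Ordinal.opow_lt_opow_iff_right Ordinal.one_lt_omega0).2 hζ)
      ((h2 β hβ).trans
        ((Ordinal.opow_lt_opow_iff_right Ordinal.one_lt_omega0).2 (hξ.add_one_lt hζ)))

theorem shift_injective (ζ : Ordinal.{u}) : Function.Injective (shift ζ) :=
  List.map_injective_iff.2 (fun _ _ h => by simpa using h)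

theorem UnitProj.mem {o : Ordinal.{u}} {G : Set (List Ordinal.{u})} {n : ℕ}
    {t w : List Ordinal.{u}} (h : UnitProj o G n t w) : t ∈ gammaN o G n ∧ w ∈ G := by
  induction h with
  | first hu => exact ⟨Or.inl ⟨_, hu, rfl⟩, hu⟩
  | later ht _ ih => exact ⟨Or.inr ⟨_, ht, _, ih.1, rfl⟩, ih.2⟩

theorem exists_unitProj {o : Ordinal.{u}} {G : Set (List Ordinal.{u})} (n : ℕ) :
    ∀ t ∈ gammaN o G n, ∃ w, UnitProj o G n t w := by
  induction n with
  | zero => intro t ht; exact absurd ht (by simp [gammaN])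
  | succ n ih =>
    rintro w (⟨t, ht, rfl⟩ | ⟨t, ht, v, hv, rfl⟩)
    · exact ⟨t, .first ht⟩
    · obtain ⟨w, hw⟩ := ih v hv
      exact ⟨w, .later ht hw⟩

/-- The terms of a block lie above those of the following blocks, which makes `ι_{ξ,n}` and `n`
functions of the sequence. -/
theorem UnitProj.unique {o : Ordinal.{u}} {G : Set (List Ordinal.{u})}
    (hG : ∀ t ∈ G, t ≠ [] ∧ ∀ α ∈ t, α < o) {n n' : ℕ} {t w w' : List Ordinal.{u}}
    (h : UnitProj o G n t w) (h' : UnitProj o G n' t w') : n = n' ∧ w = w' := by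
  have hge : ∀ (m : ℕ), ∀ t ∈ shift (o * m) '' G, t ≠ [] ∧ ∀ α ∈ t, o * m ≤ α := by
    rintro m _ ⟨t, ht, rfl⟩
    refine ⟨by simpa [shift] using (hG t ht).1, ?_⟩
    intro α hα
    obtain ⟨β, hβ, rfl⟩ := List.mem_map.1 hα
    exact le_self_add
  have hhead : ∀ {m : ℕ} {t w : List Ordinal.{u}}, UnitProj o G (m + 1) t w →
      ∃ α r, t = α :: r ∧ o * m ≤ α := by
    intro m t w h
    cases h with
    | first hu =>
      obtain ⟨h1, h2⟩ := hge m _ ⟨_, hu, rfl⟩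
      obtain ⟨α, r, hr⟩ := List.exists_cons_of_ne_nil h1
      exact ⟨α, r, hr, h2 α (by simp [hr])⟩
    | later ht h =>
      obtain ⟨h1, h2⟩ := hge m _ ht.1
      obtain ⟨α, r, rfl⟩ := List.exists_cons_of_ne_nil h1
      exact ⟨α, _, rfl, h2 α (by simp)⟩
  have hle : ∀ {m m' : ℕ} {t w w' : List Ordinal.{u}}, UnitProj o G m t w →
      UnitProj o G m' t w' → m ≤ m' := by
    intro m m' t w w' h h'
    by_contra! hlt
    obtain ⟨k, rfl⟩ : ∃ k, m = k + 1 := ⟨m - 1, by omega⟩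
    obtain ⟨α, r, rfl, hα⟩ := hhead h
    have h2 := (gammaN_bound hG m' _ h'.mem.1).2 α (by simp)
    have h3 : o * (m' : Ordinal.{u}) ≤ o * (k : Ordinal.{u}) := by
      gcongr
      omega
    exact absurd (h2.trans_le (h3.trans hα)) (lt_irrefl _)
  have hn : n = n' := le_antisymm (hle h h') (hle h' h)
  subst hn
  refine ⟨rfl, ?_⟩
  -- two decompositions into a high part and a low part agree
  have hsplit : ∀ {c : Ordinal.{u}} {a b a' b' : List Ordinal.{u}}, (∀ α ∈ a, c ≤ α) →
      (∀ α ∈ b, α < c) → (∀ α ∈ a', c ≤ α) → (∀ α ∈ b', α < c) → a ++ b = a' ++ b' →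
      b = b' := by
    intro c a
    induction a with
    | nil =>
      intro b a' b' _ hb ha' _ he
      cases a' with
      | nil => simpa using he
      | cons α r =>
        simp only [List.nil_append] at he
        exact absurd (hb α (by simp [he])) (not_lt.2 (ha' α (by simp)))
    | cons β s ih =>
      intro b a' b' ha hb ha' hb' he
      cases a' with
      | nil =>
        simp only [List.nil_append] at he
        exact absurd (hb' β (by simp [← he])) (not_lt.2 (ha β (by simp)))
      | cons α r =>
        simp only [List.cons_append, List.cons.injEq] at he
        exact ih (fun x hx => ha x (by simp [hx])) hb (fun x hx => ha' x (by simp [hx])) hb' he.2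
  induction h generalizing w' with
  | @first m u hu =>
    generalize hx : shift (o * m) u = x at h'
    cases h' with
    | first hu' => exact shift_injective _ hx
    | @later _ t' v' _ ht' h'' =>
      have hb := gammaN_bound hG m _ h''.mem.1
      obtain ⟨α, r, hr⟩ := List.exists_cons_of_ne_nil hb.1
      have h1 := (hge m _ ⟨_, hu, rfl⟩).2 α (by simp [hx, hr])
      exact absurd (hb.2 α (by simp [hr])) (not_lt.2 h1)
  | @later m t v u ht h ih =>
    generalize hx : t ++ v = x at h'
    have hb := gammaN_bound hG m _ h.mem.1
    cases h' with
    | @first _ u' hu' =>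
      obtain ⟨α, r, hr⟩ := List.exists_cons_of_ne_nil hb.1
      have h1 := (hge m _ ⟨_, hu', rfl⟩).2 α (by simp [← hx, hr])
      exact absurd (hb.2 α (by simp [hr])) (not_lt.2 h1)
    | @later _ t' v' _ ht' h'' =>
      have hb' := gammaN_bound hG m _ h''.mem.1
      have hv : v = v' := hsplit (hge m _ ht.1).2 hb.2 (hge m _ ht'.1).2 hb'.2 hx
      subst hv
      exact ih h''

/-- `ℙ_ξ` is defined, and has a single value, at each member of `Γ_ξ`. -/
theorem existsUnique_isWeight (ξ : Ordinal.{u}) : ∀ t ∈ gamma ξ, ∃! p, IsWeight ξ t p := by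
  induction ξ using Ordinal.limitRecOn with
  | zero =>
    intro t ht
    rw [gamma_zero] at ht
    obtain rfl : t = [0] := ht
    refine ⟨1, .zero, ?_⟩
    intro q hq
    generalize h0 : (0 : Ordinal.{u}) = ξ at hq
    generalize [ξ] = l at hq
    cases hq with
    | zero => rfl
    | @succ ζ => exact absurd h0.symm (by simp)
    | limit hξ _ _ _ => exact absurd h0.symm hξ.ne_bot
  | add_one ξ ih =>
    intro t ht
    rw [gamma_succ, Set.mem_iUnion] at ht
    obtain ⟨n, hn⟩ := ht
    obtain ⟨w, hw⟩ := exists_unitProj n t hn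
    obtain ⟨p, hp, hpu⟩ := ih w hw.mem.2
    refine ⟨_, .succ hw hp, ?_⟩
    intro q hq
    generalize h0 : ξ + 1 = η at hq
    cases hq with
    | zero => exact absurd h0 (by simp)
    | @succ ζ n' _ w' p' hw' hp' =>
      obtain rfl : ξ = ζ := by simpa using h0
      obtain ⟨rfl, rfl⟩ := hw.unique (gamma_bound ξ) hw'
      rw [hpu p' hp']
    | limit hξ _ _ _ => exact absurd (h0 ▸ hξ) (by simp)
  | limit ξ hξ ih =>
    intro t ht
    rw [gamma_limit hξ] at ht
    obtain ⟨ζ, hζ, s, hs, rfl⟩ := ht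
    obtain ⟨p, hp, hpu⟩ := ih (ζ + 1) (hξ.add_one_lt hζ) s hs
    refine ⟨p, .limit hξ hζ hs hp, ?_⟩
    intro q hq
    generalize hx : shift (ω ^ ζ) s = x at hq
    cases hq with
    | zero => exact absurd rfl hξ.ne_bot
    | @succ η => exact absurd hξ (by simp)
    | @limit _ ζ' s' _ _ hζ' hs' hp' =>
      have hlt : ∀ {a b : Ordinal.{u}} {r r' : List Ordinal.{u}}, r ∈ gamma (a + 1) →
          shift (ω ^ a) r = shift (ω ^ b) r' → ¬ a < b := by
        intro a b r r' hr he hab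
        obtain ⟨h1, h2⟩ := gamma_bound _ r hr
        obtain ⟨α, l, rfl⟩ := List.exists_cons_of_ne_nil h1
        cases r' with
        | nil => simp [shift] at he
        | cons β l' =>
          have he' : ω ^ a + α = ω ^ b + β := by
            simp only [shift, List.map_cons, List.cons.injEq] at he
            exact he.1
          have h3 : ω ^ a + α < ω ^ (a + 1) := Ordinal.isPrincipal_add_omega0_opow _
            ((Ordinal.opow_lt_opow_iff_right Ordinal.one_lt_omega0).2 (by simp)) (h2 α (by simp))
          have h4 : ω ^ (a + 1) ≤ ω ^ b :=
            Ordinal.opow_le_opow_right Ordinal.omega0_pos (Order.add_one_le_of_lt hab)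
          exact absurd ((h3.trans_le h4).trans_le (le_self_add.trans he'.ge)) (lt_irrefl _)
      obtain rfl : ζ = ζ' := le_antisymm (not_lt.1 (hlt hs' hx.symm)) (not_lt.1 (hlt hs hx))
      obtain rfl := shift_injective _ hx
      exact hpu _ hp'

/-- `SD`: the sequences of pairs whose sequence of first terms lies in `S`, and whose second terms
are arbitrary members of `D`. -/
def withDir {Λ : Type*} (S : Set (List Λ)) (D : Type*) : Set (List (Λ × D)) :=
  {t | t.map Prod.fst ∈ S}

/-- `Ω_ξ = Γ_ξ D`. -/
noncomputable abbrev omegaTree (ξ : Ordinal.{u}) (D : Type v) : Set (List (Ordinal.{u} × D)) :=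
  withDir (gamma ξ) D

/-- The function `ℙ_ξ` on `Ω_ξ`; its value does not depend on the terms in `D`. -/
noncomputable def weight {ξ : Ordinal.{u}} {D : Type v} (s : omegaTree ξ D) : ℝ :=
  (existsUnique_isWeight ξ (s.1.map Prod.fst) s.2).choose

/-- An extended pruning `(θ, e) : S₁D → S₂D`. -/
structure ExtendedPruning {Λ₁ Λ₂ : Type*} (S₁ : Set (List Λ₁)) (S₂ : Set (List Λ₂))
    (D : Type*) [LE D] where
  /-- the pruning `θ` -/
  toFun : withDir S₁ D → withDir S₂ D
  /-- the map `e` on the maximal sequences -/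
  ext : maxSet (withDir S₁ D) → maxSet (withDir S₂ D)
  monotone : ∀ s t : withDir S₁ D, Prec s.1 t.1 → Prec (toFun s).1 (toFun t).1
  dir_le : ∀ (s : withDir S₁ D) (s₁ : List (Λ₁ × D)) (ζ : Λ₁) (U : D) (s₂ : List (Λ₂ × D)) (ζ' : Λ₂)
    (U' : D), s.1 = s₁ ++ [(ζ, U)] → (toFun s).1 = s₂ ++ [(ζ', U')] → U ≤ U'
  prefix_ext : ∀ t : maxSet (withDir S₁ D), (toFun ⟨t.1, t.2.1⟩).1 <+: (ext t).1

/-- The map `(s, t) ↦ (θ s, e t)` from `Π S₁D` to `Π S₂D`. -/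
def ExtendedPruning.piMap {Λ₁ Λ₂ D : Type*} [LE D] {S₁ : Set (List Λ₁)} {S₂ : Set (List Λ₂)}
    (E : ExtendedPruning S₁ S₂ D) (p : piSet (withDir S₁ D)) : piSet (withDir S₂ D) :=
  ⟨((E.toFun ⟨p.1.1, p.2.1⟩).1, (E.ext ⟨p.1.2, p.2.2.1⟩).1),
    (E.toFun ⟨p.1.1, p.2.1⟩).2, (E.ext ⟨p.1.2, p.2.2.1⟩).2, by
      refine List.IsPrefix.trans ?_ (E.prefix_ext ⟨p.1.2, p.2.2.1⟩)
      by_cases h : p.1.1 = p.1.2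
      · simp only [h]
        exact List.prefix_rfl
      · exact (E.monotone ⟨p.1.1, p.2.1⟩ ⟨p.1.2, p.2.2.1.1⟩ ⟨p.2.2.2, h⟩).1⟩

/-- `f : Π Ω_ξ → ℝ` is `ε`-large: for each `δ > 0` some extended pruning `(θ, e) : Ω_ξ → Ω_ξ` has
`f (θ s, e t) ≥ ε - δ` for all `(s, t) ∈ Π Ω_ξ`. -/
def IsLarge {ξ : Ordinal.{u}} {D : Type v} [LE D] (ε : ℝ) (f : piSet (omegaTree ξ D) → ℝ) : Prop :=
  ∀ δ : ℝ, 0 < δ → ∃ E : ExtendedPruning (gamma ξ) (gamma ξ) D, ∀ p : piSet (omegaTree ξ D),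
    ε - δ ≤ f (E.piMap p)

/-- A finite sequence has finitely many initial segments. -/
noncomputable instance fintypePrefix {Λ : Type*} (S : Set (List Λ)) (t : List Λ) :
    Fintype {s : S // s.1 <+: t} :=
  @Fintype.ofFinite _ (by
    have h : Finite {s : List Λ // s ∈ t.inits} := List.finite_toSet _
    exact Finite.of_injective
      (fun s : {s : S // s.1 <+: t} =>
        (⟨s.1.1, (List.mem_inits _ _).2 s.2⟩ : {s : List Λ // s ∈ t.inits}))
      (fun a b hab => by
        have := congrArg Subtype.val hab
        exact Subtype.ext (Subtype.ext this)))

/-- The weighted average `∑ s ≼ t, ℙ_ξ(s) f(s, t)` of `f` along the branch below `t ∈ MAX Ω_ξ`. -/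
noncomputable def branchAverage {ξ : Ordinal.{u}} {D : Type v} (f : piSet (omegaTree ξ D) → ℝ)
    (t : maxSet (omegaTree ξ D)) : ℝ :=
  ∑ s : {s : omegaTree ξ D // s.1 <+: t.1}, weight s.1 * f ⟨(s.1.1, t.1), s.1.2, t.2, s.2⟩

end BTree

/-! The theorem follows from the existence, for each `ξ`, of one ultrafilter `V` on the branches of
`Ω_ξ` that turns large averages into large functions (`IsAveraging`): if a bounded `g` has averages
whose limit along `V` exceeds `c`, then some extended pruning `(θ, e)` satisfies `g (θ s) (e t) ≥
c`, and `e` can be made to take values in any prescribed member of `V`. If the infimum were `m > 0`,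
each branch would have an index `i` whose average is at least `ε i + m`. An ultrafilter selects one
of finitely many alternatives, so a single `i` serves on a member of `V`; the limit for `f i` is
then at least `ε i + m`, and `f i` is `ε i`-large, a contradiction.

The ultrafilter is built by induction on `ξ`. For `ξ = 0` it refines the filter of tails of `D`. For
limit `ξ` the ultrafilters of the pieces `ω ^ ζ + Γ_{ζ+1}` are integrated along an ultrafilter
containing all tails of `ξ`; a piece is pruned into a later piece with large averages, which is
possible because the trees increase up to prunings (`prunable_omegaTree_of_le`).

The successor step carries the weight. Iterating `V` over `n` blocks gives `blockUltra ξ V n`, and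
`n` then tends to infinity along a nonprincipal ultrafilter. An average over `n` blocks is the mean
of the block averages (`average_block`). Each block contributes at most `C`, so a sum above `n * c +
m * (C - c)` forces at least `m` blocks to contribute more than `c`. `IsAveraging.prunable_block`
makes this counting into a pruning: blocks with small contribution are replaced by one fixed
sequence, and blocks with large contribution receive the blocks of `Γ_{ξ,m}` by grafting
(`Prunable.graft`). As `m` is arbitrary, all of `Γ_{ξ+1}` can be pruned. -/

namespace BTree

/-! ### Maximal members of sets of sequences -/

section MaxSet

variable {Λ : Type*} {S : Set (List Λ)} {s t w : List Λ}

theorem Prec.length_lt (h : Prec s t) : s.length < t.length :=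
  lt_of_le_of_ne h.1.length_le fun he => h.2 (h.1.eq_of_length he)

theorem eq_of_prefix_of_mem_maxSet (ht : t ∈ maxSet S) (hs : s ∈ S) (h : t <+: s) : t = s := by
  by_contra hne
  exact ht.2 s hs ⟨h, hne⟩

theorem prefix_of_mem_maxSet (ht : t ∈ maxSet S) (hs : s ∈ S) (htw : t <+: w) (hsw : s <+: w) :
    s <+: t := by
  rcases List.prefix_or_prefix_of_prefix hsw htw with h | h
  · exact h
  · rw [eq_of_prefix_of_mem_maxSet ht hs h]

theorem eq_of_mem_maxSet (ht : t ∈ maxSet S) (hs : s ∈ maxSet S) (htw : t <+: w) (hsw : s <+: w) :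
    s = t :=
  eq_of_prefix_of_mem_maxSet hs ht.1 (prefix_of_mem_maxSet ht hs.1 htw hsw)

/-- Two maximal members that are initial segments of one sequence are comparable, hence equal; so a
complete block splits off in only one way. -/
theorem append_inj_of_mem_maxSet {v v' : List Λ} (ht : t ∈ maxSet S) (hs : s ∈ maxSet S)
    (h : t ++ v = s ++ v') : t = s ∧ v = v' := by
  obtain rfl : s = t := eq_of_mem_maxSet ht hs (List.prefix_append t v) (h ▸ List.prefix_append s v')
  exact ⟨rfl, List.append_cancel_left h⟩

theorem prec_append_iff (a b c : List Λ) : Prec (a ++ b) (a ++ c) ↔ Prec b c := by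
  simp [Prec]

theorem mem_maxSet_image {Λ' : Type*} {φ : List Λ → List Λ'}
    (hφ : ∀ a b, Prec (φ a) (φ b) ↔ Prec a b) (hi : Function.Injective φ) {a : List Λ} :
    φ a ∈ maxSet (φ '' S) ↔ a ∈ maxSet S := by
  constructor
  · rintro ⟨h1, h2⟩
    exact ⟨(hi.mem_set_image).1 h1, fun b hb h => h2 _ ⟨b, hb, rfl⟩ ((hφ _ _).2 h)⟩
  · rintro ⟨h1, h2⟩
    refine ⟨⟨a, h1, rfl⟩, ?_⟩
    rintro _ ⟨b, hb, rfl⟩ h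
    exact h2 b hb ((hφ _ _).1 h)

theorem maxSet_image {Λ' : Type*} {φ : List Λ → List Λ'}
    (hφ : ∀ a b, Prec (φ a) (φ b) ↔ Prec a b) (hi : Function.Injective φ) :
    maxSet (φ '' S) = φ '' maxSet S := by
  ext w
  constructor
  · intro h
    obtain ⟨a, -, rfl⟩ := h.1
    exact ⟨a, (mem_maxSet_image hφ hi).1 h, rfl⟩
  · rintro ⟨a, ha, rfl⟩
    exact (mem_maxSet_image hφ hi).2 ha

theorem maxSet_iUnion {ι : Type*} {S : ι → Set (List Λ)}
    (hS : ∀ i j s t, s ∈ S i → t ∈ S j → s <+: t → i = j) :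
    maxSet (⋃ i, S i) = ⋃ i, maxSet (S i) := by
  ext t
  simp only [Set.mem_iUnion]
  constructor
  · rintro ⟨h1, h2⟩
    obtain ⟨i, hi⟩ := Set.mem_iUnion.1 h1
    exact ⟨i, hi, fun s hs => h2 s (Set.mem_iUnion.2 ⟨i, hs⟩)⟩
  · rintro ⟨i, h1, h2⟩
    refine ⟨Set.mem_iUnion.2 ⟨i, h1⟩, fun s hs hts => ?_⟩
    obtain ⟨j, hj⟩ := Set.mem_iUnion.1 hs
    obtain rfl := hS i j t s h1 hj hts.1
    exact h2 s hj hts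

theorem prec_map_iff {Λ' : Type*} {f : Λ → Λ'} (hf : Function.Injective f) (a b : List Λ) :
    Prec (a.map f) (b.map f) ↔ Prec a b := by
  rw [Prec, Prec, List.prefix_map_iff_of_injective hf, Ne, (List.map_injective_iff.2 hf).eq_iff]

theorem prec_map_of_prec {Λ' : Type*} (f : Λ → Λ') {a b : List Λ} (h : Prec a b) :
    Prec (a.map f) (b.map f) := by
  refine ⟨h.1.map f, fun he => ?_⟩
  have := congrArg List.length he
  simp only [List.length_map] at this
  exact h.length_lt.ne this

/-- A proper extension of the first coordinates lifts to one of pairs by repeating any fixed element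
of `D`. -/
theorem maxSet_withDir (S : Set (List Λ)) (D : Type*) [Nonempty D] :
    maxSet (withDir S D) = withDir (maxSet S) D := by
  ext t
  constructor
  · rintro ⟨h1, h2⟩
    refine ⟨h1, fun r hr hp => ?_⟩
    obtain ⟨x, rfl⟩ := hp.1
    obtain ⟨d⟩ := ‹Nonempty D›
    refine h2 (t ++ x.map fun l => (l, d)) ?_ ⟨List.prefix_append _ _, ?_⟩
    · simpa [withDir, Function.comp_def] using hr
    · intro he
      apply hp.2
      have := congrArg (List.map Prod.fst) he
      simpa [Function.comp_def] using this
  · rintro ⟨h1, h2⟩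
    exact ⟨h1, fun r hr hp => h2 _ hr (prec_map_of_prec _ hp)⟩

end MaxSet

/-! ### Translation of the first coordinates -/

section Shift

variable {D : Type v}

/-- `ζ + (ζᵢ, Uᵢ)ᵢ = (ζ + ζᵢ, Uᵢ)ᵢ`. -/
def shiftDir (ζ : Ordinal.{u}) (t : List (Ordinal.{u} × D)) : List (Ordinal.{u} × D) :=
  t.map (Prod.map (fun α => ζ + α) id)

theorem map_fst_shiftDir (ζ : Ordinal.{u}) (t : List (Ordinal.{u} × D)) :
    (shiftDir ζ t).map Prod.fst = shift ζ (t.map Prod.fst) := by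
  simp [shiftDir, shift, Function.comp_def]

theorem map_snd_shiftDir (ζ : Ordinal.{u}) (t : List (Ordinal.{u} × D)) :
    (shiftDir ζ t).map Prod.snd = t.map Prod.snd := by
  simp [shiftDir, Function.comp_def]

theorem prodMap_add_injective (ζ : Ordinal.{u}) :
    Function.Injective (Prod.map (fun α => ζ + α) id : Ordinal.{u} × D → Ordinal.{u} × D) :=
  Function.Injective.prodMap (fun _ _ h => by simpa using h) Function.injective_id

theorem shiftDir_injective (ζ : Ordinal.{u}) :
    Function.Injective (shiftDir ζ : List (Ordinal.{u} × D) → _) :=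
  List.map_injective_iff.2 (prodMap_add_injective ζ)

theorem shiftDir_zero (t : List (Ordinal.{u} × D)) : shiftDir 0 t = t :=
  (List.map_congr_left fun x _ => by simp [Prod.map]).trans (List.map_id t)

theorem shiftDir_prefix_iff (ζ : Ordinal.{u}) (a b : List (Ordinal.{u} × D)) :
    shiftDir ζ a <+: shiftDir ζ b ↔ a <+: b :=
  List.prefix_map_iff_of_injective (prodMap_add_injective ζ)

theorem shiftDir_prec_iff (ζ : Ordinal.{u}) (a b : List (Ordinal.{u} × D)) :
    Prec (shiftDir ζ a) (shiftDir ζ b) ↔ Prec a b :=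
  prec_map_iff (prodMap_add_injective ζ) a b

theorem exists_shiftDir (ζ : Ordinal.{u}) (t : List Ordinal.{u}) (s : List (Ordinal.{u} × D))
    (h : s.map Prod.fst = shift ζ t) : ∃ r, r.map Prod.fst = t ∧ s = shiftDir ζ r := by
  induction t generalizing s with
  | nil => exact ⟨[], rfl, by simpa [shift, shiftDir] using h⟩
  | cons α t ih =>
    cases s with
    | nil => simp [shift] at h
    | cons x s =>
      simp only [shift, List.map_cons, List.cons.injEq] at h
      obtain ⟨r, rfl, rfl⟩ := ih s h.2
      exact ⟨(α, x.2) :: r, rfl, by simp [shiftDir, ← h.1]⟩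

theorem withDir_shift (ζ : Ordinal.{u}) (S : Set (List Ordinal.{u})) :
    withDir (shift ζ '' S) D = shiftDir ζ '' withDir S D := by
  ext s
  constructor
  · rintro ⟨t, ht, h⟩
    obtain ⟨r, rfl, rfl⟩ := exists_shiftDir ζ t s h.symm
    exact ⟨r, ht, rfl⟩
  · rintro ⟨r, hr, rfl⟩
    exact ⟨_, hr, (map_fst_shiftDir ζ r).symm⟩

theorem maxSet_shiftDir (ζ : Ordinal.{u}) (S : Set (List (Ordinal.{u} × D))) :
    maxSet (shiftDir ζ '' S) = shiftDir ζ '' maxSet S :=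
  maxSet_image (shiftDir_prec_iff ζ) (shiftDir_injective ζ)

theorem maxSet_shift (ζ : Ordinal.{u}) (S : Set (List Ordinal.{u})) :
    maxSet (shift ζ '' S) = shift ζ '' maxSet S :=
  maxSet_image (fun a b => prec_map_iff (fun _ _ h => by simpa using h) a b) (shift_injective ζ)

end Shift

/-! ### The trees `Γ_{ξ,n} D` and their maximal members -/

section Blocks

variable {D : Type v}

/-- The tree `Γ_{ξ,n} D`. -/
abbrev blockTree (ξ : Ordinal.{u}) (D : Type v) (n : ℕ) : Set (List (Ordinal.{u} × D)) :=
  withDir (gammaN (ω ^ ξ) (gamma ξ) n) D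

/-- The concatenations of `n` successive maximal blocks: the maximal members of `Γ_{ξ,n} D` if
`n ≠ 0`, and the empty sequence alone if `n = 0`. -/
def blockBranch (ξ : Ordinal.{u}) (D : Type v) : ℕ → Set (List (Ordinal.{u} × D))
  | 0 => {[]}
  | n + 1 => {w | ∃ t ∈ maxSet (omegaTree ξ D), ∃ v ∈ blockBranch ξ D n,
      w = shiftDir (ω ^ ξ * n) t ++ v}

theorem blockTree_zero (ξ : Ordinal.{u}) : blockTree ξ D 0 = ∅ := by
  ext s
  simp [withDir, gammaN]

theorem mem_blockTree_succ [Nonempty D] {ξ : Ordinal.{u}} {n : ℕ} {w : List (Ordinal.{u} × D)} :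
    w ∈ blockTree ξ D (n + 1) ↔ (∃ t ∈ omegaTree ξ D, w = shiftDir (ω ^ ξ * n) t) ∨
      ∃ t ∈ maxSet (omegaTree ξ D), ∃ v ∈ blockTree ξ D n, w = shiftDir (ω ^ ξ * n) t ++ v := by
  rw [maxSet_withDir]
  constructor
  · rintro (⟨t, ht, h⟩ | ⟨t, ht, v, hv, h⟩)
    · obtain ⟨r, rfl, rfl⟩ := exists_shiftDir _ t w h.symm
      exact Or.inl ⟨r, ht, rfl⟩
    · obtain ⟨a, b, rfl, rfl, rfl⟩ := List.map_eq_append_iff.1 h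
      rw [maxSet_shift] at ht
      obtain ⟨t, ht, h'⟩ := ht
      obtain ⟨r, rfl, rfl⟩ := exists_shiftDir _ t a h'.symm
      exact Or.inr ⟨r, ht, b, hv, rfl⟩
  · rintro (⟨t, ht, rfl⟩ | ⟨t, ht, v, hv, rfl⟩)
    · exact Or.inl ⟨_, ht, (map_fst_shiftDir _ t).symm⟩
    · refine Or.inr ⟨shift (ω ^ ξ * n) (t.map Prod.fst), ?_, v.map Prod.fst, hv, ?_⟩
      · rw [maxSet_shift]
        exact ⟨_, ht, rfl⟩
      · rw [List.map_append, map_fst_shiftDir]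

theorem omegaTree_succ (ξ : Ordinal.{u}) : omegaTree (ξ + 1) D = ⋃ n, blockTree ξ D n := by
  ext s
  simp only [omegaTree, withDir, gamma_succ, Set.mem_iUnion, Set.mem_ofPred_eq]

theorem omegaTree_limit {ξ : Ordinal.{u}} (hξ : IsSuccLimit ξ) :
    omegaTree ξ D = ⋃ ζ : Set.Iio ξ, shiftDir (ω ^ ζ.1) '' omegaTree (ζ.1 + 1) D := by
  ext s
  simp only [← withDir_shift, Set.mem_iUnion]
  simp only [omegaTree, withDir, gamma_limit hξ, Set.mem_ofPred_eq, Set.mem_image, Subtype.exists,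
    Set.mem_Iio, exists_prop, eq_comm]

theorem omegaTree_ne_nil {ξ : Ordinal.{u}} {s : List (Ordinal.{u} × D)} (hs : s ∈ omegaTree ξ D) :
    s ≠ [] := by
  rintro rfl
  exact (gamma_bound ξ _ hs).1 rfl

theorem blockTree_ne_nil {ξ : Ordinal.{u}} {n : ℕ} {s : List (Ordinal.{u} × D)}
    (hs : s ∈ blockTree ξ D n) : s ≠ [] := by
  rintro rfl
  exact (gammaN_bound (gamma_bound ξ) n _ hs).1 rfl

theorem blockTree_subset (ξ : Ordinal.{u}) (n : ℕ) : blockTree ξ D n ⊆ omegaTree (ξ + 1) D := by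
  rw [omegaTree_succ]
  exact Set.subset_iUnion _ n

theorem exists_head_of_mem_gammaN {o : Ordinal.{u}} {G : Set (List Ordinal.{u})}
    (hG : ∀ t ∈ G, t ≠ [] ∧ ∀ α ∈ t, α < o) {n : ℕ} {t : List Ordinal.{u}}
    (ht : t ∈ gammaN o G (n + 1)) : ∃ α r, t = α :: r ∧ o * n ≤ α := by
  have key : ∀ x ∈ shift (o * n) '' G, ∃ α r, x = α :: r ∧ o * n ≤ α := by
    rintro _ ⟨x, hx, rfl⟩
    obtain ⟨α, r, rfl⟩ := List.exists_cons_of_ne_nil (hG x hx).1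
    exact ⟨_, _, rfl, le_self_add⟩
  rcases ht with ht | ⟨x, hx, v, -, rfl⟩
  · exact key t ht
  · obtain ⟨α, r, rfl, h⟩ := key x hx.1
    exact ⟨α, r ++ v, rfl, h⟩

/-- Sequences in `Γ_{ξ,n+1}` start at or above `ω ^ ξ * n`, while all terms of those in `Γ_{ξ,k}`
lie below `ω ^ ξ * k`. Hence the first term alone determines the number of blocks. -/
theorem index_le_of_head?_eq {o : Ordinal.{u}} {G : Set (List Ordinal.{u})}
    (hG : ∀ t ∈ G, t ≠ [] ∧ ∀ α ∈ t, α < o) {n k : ℕ} {s t : List Ordinal.{u}}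
    (hs : s ∈ gammaN o G n) (ht : t ∈ gammaN o G k) (h : s.head? = t.head?) : n ≤ k := by
  cases n with
  | zero => exact Nat.zero_le k
  | succ n =>
    by_contra! hlt
    obtain ⟨α, r, rfl, hα⟩ := exists_head_of_mem_gammaN hG hs
    have h2 := (gammaN_bound hG k t ht).2 α (List.mem_of_mem_head? (by simp [← h]))
    have h3 : o * (k : Ordinal.{u}) ≤ o * (n : Ordinal.{u}) := by
      gcongr
      omega
    exact absurd (h2.trans_le (h3.trans hα)) (lt_irrefl _)

theorem head?_eq_of_prefix {Λ : Type*} {s t : List Λ} (hs : s ≠ []) (h : s <+: t) :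
    s.head? = t.head? := by
  obtain ⟨x, rfl⟩ := h
  simp [List.head?_append, List.head?_eq_some_head hs]

theorem blockTree_index_eq {ξ : Ordinal.{u}} {n k : ℕ} {s t : List (Ordinal.{u} × D)}
    (hs : s ∈ blockTree ξ D n) (ht : t ∈ blockTree ξ D k) (h : s <+: t) : n = k := by
  have hd := head?_eq_of_prefix (by simpa using blockTree_ne_nil hs) (h.map Prod.fst)
  exact le_antisymm (index_le_of_head?_eq (gamma_bound ξ) hs ht hd)
    (index_le_of_head?_eq (gamma_bound ξ) ht hs hd.symm)

/-- Since `ω ^ (ζ + 1)` is additively principal, the first term of `ω ^ ζ + s` lies between `ω ^ ζ`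
and `ω ^ (ζ + 1)`, and these intervals are disjoint for different `ζ`. -/
theorem shift_index_le {ζ η : Ordinal.{u}} {s t : List (Ordinal.{u} × D)}
    (hs : s ∈ omegaTree (ζ + 1) D) (ht : t ∈ omegaTree (η + 1) D)
    (h : ((shiftDir (ω ^ ζ) s).map Prod.fst).head? = ((shiftDir (ω ^ η) t).map Prod.fst).head?) :
    η ≤ ζ := by
  by_contra! hlt
  obtain ⟨h1, h2⟩ := gamma_bound _ _ hs
  obtain ⟨α, l, hl⟩ := List.exists_cons_of_ne_nil h1
  obtain ⟨β, l', hl'⟩ := List.exists_cons_of_ne_nil (gamma_bound _ _ ht).1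
  have he : ω ^ ζ + α = ω ^ η + β := by
    simpa [map_fst_shiftDir, hl, hl', shift] using h
  have h3 : ω ^ ζ + α < ω ^ (ζ + 1) := Ordinal.isPrincipal_add_omega0_opow _
    ((Ordinal.opow_lt_opow_iff_right Ordinal.one_lt_omega0).2 (by simp)) (h2 α (by simp [hl]))
  have h4 : ω ^ (ζ + 1) ≤ ω ^ η :=
    Ordinal.opow_le_opow_right Ordinal.omega0_pos (Order.add_one_le_of_lt hlt)
  exact absurd ((h3.trans_le h4).trans_le (le_self_add.trans he.ge)) (lt_irrefl _)

theorem shift_index_eq {ξ : Ordinal.{u}} (ζ η : Set.Iio ξ) (s t : List (Ordinal.{u} × D))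
    (hs : s ∈ shiftDir (ω ^ ζ.1) '' omegaTree (ζ.1 + 1) D)
    (ht : t ∈ shiftDir (ω ^ η.1) '' omegaTree (η.1 + 1) D) (h : s <+: t) : ζ = η := by
  obtain ⟨s, hs, rfl⟩ := hs
  obtain ⟨t, ht, rfl⟩ := ht
  have hd := head?_eq_of_prefix (by simpa [shiftDir] using omegaTree_ne_nil hs) (h.map Prod.fst)
  exact Subtype.ext (le_antisymm (shift_index_le ht hs hd.symm) (shift_index_le hs ht hd))

theorem maxSet_omegaTree_limit {ξ : Ordinal.{u}} (hξ : IsSuccLimit ξ) :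
    maxSet (omegaTree ξ D) =
      ⋃ ζ : Set.Iio ξ, shiftDir (ω ^ ζ.1) '' maxSet (omegaTree (ζ.1 + 1) D) := by
  rw [omegaTree_limit hξ, maxSet_iUnion shift_index_eq]
  simp only [maxSet_shiftDir]

theorem omegaTree_zero : omegaTree 0 D = {s | ∃ U, s = [(0, U)]} := by
  ext s
  simp only [omegaTree, withDir, gamma_zero, Set.mem_ofPred_eq, Set.mem_singleton_iff]
  constructor
  · intro h
    obtain ⟨x, rfl, hx⟩ : ∃ x, s = [x] ∧ x.1 = 0 := by
      simpa [List.map_eq_singleton_iff] using h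
    exact ⟨x.2, by rw [← hx]⟩
  · rintro ⟨U, rfl⟩
    rfl

theorem maxSet_omegaTree_zero : maxSet (omegaTree 0 D) = omegaTree.{u} 0 D := by
  ext s
  refine ⟨fun h => h.1, fun h => ⟨h, fun t ht hst => ?_⟩⟩
  rw [omegaTree_zero] at h ht
  obtain ⟨U, rfl⟩ := h
  obtain ⟨U', rfl⟩ := ht
  simpa using hst.length_lt

theorem blockBranch_nonempty {ξ : Ordinal.{u}} (h : (maxSet (omegaTree ξ D)).Nonempty) (n : ℕ) :
    (blockBranch ξ D n).Nonempty := by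
  induction n with
  | zero => exact ⟨[], rfl⟩
  | succ n ih => exact ⟨_, _, h.some_mem, _, ih.some_mem, rfl⟩

theorem blockBranch_succ_subset [Nonempty D] {ξ : Ordinal.{u}} (n : ℕ) :
    blockBranch ξ D (n + 1) ⊆ blockTree ξ D (n + 1) := by
  induction n with
  | zero =>
    rintro _ ⟨t, ht, v, rfl, rfl⟩
    exact mem_blockTree_succ.2 (Or.inl ⟨t, ht.1, by simp⟩)
  | succ n ih =>
    rintro _ ⟨t, ht, v, hv, rfl⟩
    exact mem_blockTree_succ.2 (Or.inr ⟨t, ht, v, ih hv, rfl⟩)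

theorem maxSet_blockTree_succ [Nonempty D] {ξ : Ordinal.{u}}
    (hne : (maxSet (omegaTree ξ D)).Nonempty) (n : ℕ) :
    maxSet (blockTree ξ D (n + 1)) = blockBranch ξ D (n + 1) := by
  induction n with
  | zero =>
    have h : blockTree ξ D (0 + 1) = omegaTree ξ D := by
      rw [blockTree, zero_add, gammaN_one]
    rw [h]
    ext w
    simp [blockBranch, shiftDir_zero]
  | succ n ih =>
    ext w
    constructor
    · rintro ⟨h1, h2⟩
      rcases mem_blockTree_succ.1 h1 with ⟨t, ht, rfl⟩ | ⟨t, ht, v, hv, rfl⟩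
      · have ht' : t ∈ maxSet (omegaTree ξ D) := ⟨ht, fun s hs hts =>
          h2 _ (mem_blockTree_succ.2 (Or.inl ⟨s, hs, rfl⟩)) ((shiftDir_prec_iff _ _ _).2 hts)⟩
        -- A first block, even a complete one, can be followed by `n + 1` further blocks, so it is
        -- not maximal.
        obtain ⟨v, hv⟩ := blockBranch_nonempty hne (n + 1)
        have hv' := blockBranch_succ_subset n hv
        refine absurd ⟨List.prefix_append _ v, ?_⟩
          (h2 _ (mem_blockTree_succ.2 (Or.inr ⟨t, ht', v, hv', rfl⟩)))
        simpa using blockTree_ne_nil hv'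
      · refine ⟨t, ht, v, ?_, rfl⟩
        rw [← ih]
        exact ⟨hv, fun s hs hvs => h2 _ (mem_blockTree_succ.2 (Or.inr ⟨t, ht, s, hs, rfl⟩))
          ((prec_append_iff _ _ _).2 hvs)⟩
    · intro hw
      refine ⟨blockBranch_succ_subset _ hw, fun s hs hws => ?_⟩
      obtain ⟨t, ht, v, hv, rfl⟩ := hw
      rcases mem_blockTree_succ.1 hs with ⟨b, hb, rfl⟩ | ⟨b, hb, v', hv', rfl⟩
      · have h1 : t <+: b :=
          (shiftDir_prefix_iff _ _ _).1 ((List.prefix_append _ v).trans hws.1)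
        obtain rfl := eq_of_prefix_of_mem_maxSet ht hb h1
        simpa using hws.length_lt
      · have hm : ∀ x ∈ maxSet (omegaTree ξ D), shiftDir (ω ^ ξ * ((n + 1 : ℕ) : Ordinal.{u})) x ∈
            maxSet (shiftDir (ω ^ ξ * ((n + 1 : ℕ) : Ordinal.{u})) '' omegaTree ξ D) := by
          intro x hx
          rw [maxSet_shiftDir]
          exact ⟨x, hx, rfl⟩
        have := eq_of_mem_maxSet (hm t ht) (hm b hb)
          ((List.prefix_append _ v).trans hws.1) (List.prefix_append _ v')
        rw [this, prec_append_iff] at hws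
        rw [← ih] at hv
        exact hv.2 v' hv' hws

theorem maxSet_omegaTree_succ [Nonempty D] {ξ : Ordinal.{u}}
    (hne : (maxSet (omegaTree ξ D)).Nonempty) :
    maxSet (omegaTree (ξ + 1) D) = ⋃ n, blockBranch ξ D (n + 1) := by
  rw [omegaTree_succ, maxSet_iUnion fun i j s t hs ht h => blockTree_index_eq hs ht h]
  ext s
  simp only [Set.mem_iUnion]
  constructor
  · rintro ⟨n, hn⟩
    cases n with
    | zero => exact absurd hn.1 (by simp [blockTree_zero])
    | succ n => exact ⟨n, maxSet_blockTree_succ hne n ▸ hn⟩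
  · rintro ⟨n, hn⟩
    exact ⟨n + 1, (maxSet_blockTree_succ hne n).symm ▸ hn⟩

theorem maxSet_omegaTree_nonempty [Nonempty D] (ξ : Ordinal.{u}) :
    (maxSet (omegaTree ξ D)).Nonempty := by
  induction ξ using Ordinal.limitRecOn with
  | zero =>
    obtain ⟨U⟩ := ‹Nonempty D›
    rw [maxSet_omegaTree_zero, omegaTree_zero]
    exact ⟨_, U, rfl⟩
  | add_one ξ ih =>
    rw [maxSet_omegaTree_succ ih]
    exact (blockBranch_nonempty ih 1).mono (Set.subset_iUnion_of_subset 0 subset_rfl)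
  | limit ξ hξ ih =>
    have h0 : (0 : Ordinal.{u}) < ξ := hξ.bot_lt
    rw [maxSet_omegaTree_limit hξ]
    exact ((ih (0 + 1) (hξ.add_one_lt h0)).image _).mono
      (Set.subset_iUnion_of_subset (⟨0, h0⟩ : Set.Iio ξ) subset_rfl)

/-- The trees `Γ_ξ D` are closed under nonempty initial segments. -/
theorem mem_blockTree_of_prefix [Nonempty D] {ξ : Ordinal.{u}}
    (hξ : ∀ s t : List (Ordinal.{u} × D), t ∈ omegaTree ξ D → s <+: t → s ≠ [] → s ∈ omegaTree ξ D)
    {n : ℕ} {s t : List (Ordinal.{u} × D)} (ht : t ∈ blockTree ξ D n) (h : s <+: t) (hs : s ≠ []) :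
    s ∈ blockTree ξ D n := by
  induction n generalizing s t with
  | zero => exact absurd ht (by simp [blockTree_zero])
  | succ n ih =>
    have key : ∀ x ∈ omegaTree ξ D, s <+: shiftDir (ω ^ ξ * n) x → s ∈ blockTree ξ D (n + 1) := by
      intro x hx hsx
      obtain ⟨r, hr, rfl⟩ := List.prefix_map_iff.1 hsx
      exact mem_blockTree_succ.2 (Or.inl ⟨r, hξ r x hx hr (by simpa using hs), rfl⟩)
    rcases mem_blockTree_succ.1 ht with ⟨x, hx, rfl⟩ | ⟨x, hx, v, hv, rfl⟩
    · exact key x hx h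
    · rcases List.prefix_or_prefix_of_prefix h (List.prefix_append _ v) with h' | h'
      · exact key x hx.1 h'
      · obtain ⟨r, rfl⟩ := h'
        rw [List.prefix_append_right_inj] at h
        by_cases hr : r = []
        · subst hr
          exact key x hx.1 (by simp)
        · exact mem_blockTree_succ.2 (Or.inr ⟨x, hx, r, ih hv h hr, rfl⟩)

theorem mem_omegaTree_of_prefix [Nonempty D] (ξ : Ordinal.{u}) (s t : List (Ordinal.{u} × D))
    (ht : t ∈ omegaTree ξ D) (h : s <+: t) (hs : s ≠ []) : s ∈ omegaTree ξ D := by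
  induction ξ using Ordinal.limitRecOn generalizing s t with
  | zero =>
    rw [omegaTree_zero] at ht
    obtain ⟨U, rfl⟩ := ht
    rcases List.prefix_cons_iff.1 h with h | ⟨r, rfl, hr⟩
    · exact absurd h hs
    · rw [List.prefix_nil.1 hr, omegaTree_zero]
      exact ⟨U, rfl⟩
  | add_one ξ ih =>
    rw [omegaTree_succ, Set.mem_iUnion] at ht ⊢
    obtain ⟨n, hn⟩ := ht
    exact ⟨n, mem_blockTree_of_prefix ih hn h hs⟩
  | limit ξ hξ ih =>
    rw [omegaTree_limit hξ, Set.mem_iUnion] at ht ⊢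
    obtain ⟨ζ, x, hx, rfl⟩ := ht
    obtain ⟨r, hr, rfl⟩ := List.prefix_map_iff.1 h
    exact ⟨ζ, r, ih _ (hξ.add_one_lt ζ.2) r x hx hr (by simpa using hs), rfl⟩

end Blocks
/-! ### Weighted averages along branches -/

section Average

variable {D : Type v}

theorem IsWeight.nonneg {ξ : Ordinal.{u}} {t : List Ordinal.{u}} {p : ℝ} (h : IsWeight ξ t p) :
    0 ≤ p := by
  induction h with
  | zero => exact zero_le_one
  | succ _ _ ih => positivity
  | limit _ _ _ _ ih => exact ih

open Classical in
/-- The function `ℙ_ξ`, extended by `0` to all sequences. -/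
noncomputable def treeWeight (ξ : Ordinal.{u}) (s : List (Ordinal.{u} × D)) : ℝ :=
  if h : s ∈ omegaTree ξ D then weight ⟨s, h⟩ else 0

/-- The sum of `ℙ_ξ(s) F(s)` over the initial segments `s ∈ Ω_ξ` of `t`. -/
noncomputable def average (ξ : Ordinal.{u}) (F : List (Ordinal.{u} × D) → ℝ)
    (t : List (Ordinal.{u} × D)) : ℝ :=
  ∑ k ∈ Finset.range t.length, treeWeight ξ (t.take (k + 1)) * F (t.take (k + 1))

theorem isWeight_treeWeight {ξ : Ordinal.{u}} {s : List (Ordinal.{u} × D)}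
    (hs : s ∈ omegaTree ξ D) : IsWeight ξ (s.map Prod.fst) (treeWeight ξ s) := by
  rw [treeWeight, dif_pos hs]
  exact (existsUnique_isWeight ξ (s.map Prod.fst) hs).choose_spec.1

theorem treeWeight_eq {ξ : Ordinal.{u}} {s : List (Ordinal.{u} × D)}
    (hs : s ∈ omegaTree ξ D) {p : ℝ} (h : IsWeight ξ (s.map Prod.fst) p) : treeWeight ξ s = p :=
  (existsUnique_isWeight ξ (s.map Prod.fst) hs).unique (isWeight_treeWeight hs) h

theorem treeWeight_nonneg (ξ : Ordinal.{u}) (s : List (Ordinal.{u} × D)) : 0 ≤ treeWeight ξ s := by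
  by_cases hs : s ∈ omegaTree ξ D
  · exact (isWeight_treeWeight hs).nonneg
  · rw [treeWeight, dif_neg hs]

theorem treeWeight_block_first [Nonempty D] {ξ : Ordinal.{u}} {n : ℕ}
    {s : List (Ordinal.{u} × D)} (hs : s ∈ omegaTree ξ D) :
    (n + 1 : ℝ) * treeWeight (ξ + 1) (shiftDir (ω ^ ξ * n) s) = treeWeight ξ s := by
  have hmem : shiftDir (ω ^ ξ * n) s ∈ omegaTree (ξ + 1) D :=
    blockTree_subset ξ (n + 1) (mem_blockTree_succ.2 (Or.inl ⟨s, hs, rfl⟩))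
  rw [treeWeight_eq hmem (p := 1 / ((n + 1 : ℕ) : ℝ) * treeWeight ξ s)]
  · push_cast
    field_simp
  · rw [map_fst_shiftDir]
    exact .succ (.first hs) (isWeight_treeWeight hs)

/-- Removing the first block does not change the image under `ι`; only the factor `1 / n` becomes `1
/ (n + 1)`. -/
theorem treeWeight_block_later [Nonempty D] {ξ : Ordinal.{u}} {n : ℕ}
    {t s : List (Ordinal.{u} × D)} (ht : t ∈ maxSet (omegaTree ξ D)) (hs : s ∈ blockTree ξ D n) :
    (n + 1 : ℝ) * treeWeight (ξ + 1) (shiftDir (ω ^ ξ * n) t ++ s) =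
      n * treeWeight (ξ + 1) s := by
  have hmem : shiftDir (ω ^ ξ * n) t ++ s ∈ omegaTree (ξ + 1) D :=
    blockTree_subset ξ (n + 1) (mem_blockTree_succ.2 (Or.inr ⟨t, ht, s, hs, rfl⟩))
  obtain ⟨w, hw⟩ := exists_unitProj n _ hs
  obtain ⟨p, hp, -⟩ := existsUnique_isWeight ξ w hw.mem.2
  have hn : n ≠ 0 := by
    rintro rfl
    simp [blockTree_zero] at hs
  rw [treeWeight_eq hmem (p := 1 / ((n + 1 : ℕ) : ℝ) * p),
    treeWeight_eq (blockTree_subset ξ n hs) (.succ hw hp)]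
  · push_cast
    field_simp
  · rw [List.map_append, map_fst_shiftDir]
    refine .succ (.later ?_ hw) hp
    rw [maxSet_shift]
    rw [maxSet_withDir] at ht
    exact ⟨_, ht, rfl⟩

theorem mem_blockTree_of_prefix_branch [Nonempty D] {ξ : Ordinal.{u}} {n : ℕ}
    {s t : List (Ordinal.{u} × D)} (ht : t ∈ blockBranch ξ D n) (h : s <+: t) (hs : s ≠ []) :
    s ∈ blockTree ξ D n := by
  cases n with
  | zero =>
    obtain rfl : t = [] := ht
    exact absurd (List.prefix_nil.1 h) hs
  | succ n =>
    exact mem_blockTree_of_prefix (mem_omegaTree_of_prefix ξ) (blockBranch_succ_subset n ht) h hs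

theorem take_succ_ne_nil {Λ : Type*} {l : List Λ} {k : ℕ} (h : k < l.length) :
    l.take (k + 1) ≠ [] := by
  intro he
  have := congrArg List.length he
  simp only [List.length_take, List.length_nil] at this
  omega

theorem average_zero (F : List (Ordinal.{u} × D) → ℝ) (U : D) :
    average 0 F [(0, U)] = F [(0, U)] := by
  have h : treeWeight 0 [((0 : Ordinal.{u}), U)] = 1 :=
    treeWeight_eq (by rw [omegaTree_zero]; exact ⟨U, rfl⟩) .zero
  simp [average, h]

/-- The sum over initial segments breaks at the end of the first block. Without the normalisation,
`n = 0` (where `v` is empty) needs no separate treatment. -/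
theorem average_block [Nonempty D] {ξ : Ordinal.{u}} {n : ℕ} (F : List (Ordinal.{u} × D) → ℝ)
    {t v : List (Ordinal.{u} × D)} (ht : t ∈ maxSet (omegaTree ξ D))
    (hv : v ∈ blockBranch ξ D n) :
    (n + 1 : ℝ) * average (ξ + 1) F (shiftDir (ω ^ ξ * n) t ++ v) =
      average ξ (fun s => F (shiftDir (ω ^ ξ * n) s)) t +
        n * average (ξ + 1) (fun s => F (shiftDir (ω ^ ξ * n) t ++ s)) v := by
  have hl : (shiftDir (ω ^ ξ * n) t).length = t.length := by simp [shiftDir]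
  rw [average, List.length_append, hl, Finset.sum_range_add, mul_add]
  congr 1
  · rw [average, Finset.mul_sum]
    refine Finset.sum_congr rfl fun k hk => ?_
    have hk' := Finset.mem_range.1 hk
    rw [List.take_append_of_le_length (by omega)]
    have he : (shiftDir (ω ^ ξ * n) t).take (k + 1) = shiftDir (ω ^ ξ * n) (t.take (k + 1)) := by
      simp [shiftDir, List.map_take]
    rw [he, ← mul_assoc, treeWeight_block_first
      (mem_omegaTree_of_prefix ξ _ _ ht.1 (List.take_prefix _ _) (take_succ_ne_nil hk'))]
  · rw [average, Finset.mul_sum, Finset.mul_sum]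
    refine Finset.sum_congr rfl fun k hk => ?_
    have hk' := Finset.mem_range.1 hk
    have he : (shiftDir (ω ^ ξ * n) t ++ v).take (t.length + k + 1) =
        shiftDir (ω ^ ξ * n) t ++ v.take (k + 1) := by
      rw [add_assoc, ← hl, List.take_length_add_append]
    rw [he, ← mul_assoc, ← mul_assoc, treeWeight_block_later ht
      (mem_blockTree_of_prefix_branch hv (List.take_prefix _ _) (take_succ_ne_nil hk'))]

theorem average_limit [Nonempty D] {ξ ζ : Ordinal.{u}} (hξ : IsSuccLimit ξ) (hζ : ζ < ξ)
    (F : List (Ordinal.{u} × D) → ℝ) {t : List (Ordinal.{u} × D)}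
    (ht : t ∈ omegaTree (ζ + 1) D) :
    average ξ F (shiftDir (ω ^ ζ) t) = average (ζ + 1) (fun s => F (shiftDir (ω ^ ζ) s)) t := by
  have hl : (shiftDir (ω ^ ζ) t).length = t.length := by simp [shiftDir]
  rw [average, average, hl]
  refine Finset.sum_congr rfl fun k hk => ?_
  have hk' := Finset.mem_range.1 hk
  have he : (shiftDir (ω ^ ζ) t).take (k + 1) = shiftDir (ω ^ ζ) (t.take (k + 1)) := by
    simp [shiftDir, List.map_take]
  have hm := mem_omegaTree_of_prefix (ζ + 1) _ _ ht (List.take_prefix (k + 1) t)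
    (take_succ_ne_nil hk')
  have hm' : shiftDir (ω ^ ζ) (t.take (k + 1)) ∈ omegaTree ξ D := by
    rw [omegaTree_limit hξ]
    exact Set.mem_iUnion.2 ⟨⟨ζ, hζ⟩, _, hm, rfl⟩
  rw [he, treeWeight_eq hm' (p := treeWeight (ζ + 1) (t.take (k + 1)))]
  rw [map_fst_shiftDir]
  exact .limit hξ hζ hm (isWeight_treeWeight hm)

/-- The weights along a branch add up to `1`. -/
theorem average_one [Nonempty D] (ξ : Ordinal.{u}) :
    ∀ t ∈ maxSet (omegaTree ξ D), average ξ (fun _ => 1) t = 1 := by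
  induction ξ using Ordinal.limitRecOn with
  | zero =>
    intro t ht
    rw [maxSet_omegaTree_zero, omegaTree_zero] at ht
    obtain ⟨U, rfl⟩ := ht
    exact average_zero _ U
  | add_one ξ ih =>
    have key : ∀ n : ℕ, ∀ t ∈ blockBranch ξ D n, n * average (ξ + 1) (fun _ => 1) t = n := by
      intro n
      induction n with
      | zero => simp
      | succ n hn =>
        rintro _ ⟨t, ht, v, hv, rfl⟩
        rw [Nat.cast_succ, average_block _ ht hv, ih t ht, hn v hv, add_comm]
    intro t ht
    rw [maxSet_omegaTree_succ (maxSet_omegaTree_nonempty ξ), Set.mem_iUnion] at ht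
    obtain ⟨n, hn⟩ := ht
    have := key _ t hn
    have h0 : ((n + 1 : ℕ) : ℝ) ≠ 0 := by positivity
    exact mul_left_cancel₀ h0 (this.trans (mul_one _).symm)
  | limit ξ hξ ih =>
    intro t ht
    rw [maxSet_omegaTree_limit hξ, Set.mem_iUnion] at ht
    obtain ⟨ζ, t, ht, rfl⟩ := ht
    rw [average_limit hξ ζ.2 _ ht.1]
    exact ih _ (hξ.add_one_lt ζ.2) t ht

theorem abs_average_le [Nonempty D] {ξ : Ordinal.{u}} {F : List (Ordinal.{u} × D) → ℝ} {C : ℝ}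
    (hF : ∀ s, |F s| ≤ C) {t : List (Ordinal.{u} × D)} (ht : t ∈ maxSet (omegaTree ξ D)) :
    |average ξ F t| ≤ C := by
  calc |average ξ F t| ≤ ∑ k ∈ Finset.range t.length,
        |treeWeight ξ (t.take (k + 1)) * F (t.take (k + 1))| := Finset.abs_sum_le_sum_abs _ _
    _ ≤ ∑ k ∈ Finset.range t.length, C * (treeWeight ξ (t.take (k + 1)) * 1) := by
        refine Finset.sum_le_sum fun k _ => ?_
        rw [abs_mul, abs_of_nonneg (treeWeight_nonneg _ _), mul_one, mul_comm C]
        exact mul_le_mul_of_nonneg_left (hF _) (treeWeight_nonneg _ _)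
    _ = C := by
        rw [← Finset.mul_sum]
        have := average_one ξ t ht
        rw [average] at this
        rw [this, mul_one]

-- An initial segment of `t` is determined by its length, and length `k + 1` corresponds to the
-- index `k`. Indices whose segment lies outside the tree have weight `0`.
open Classical in
theorem branchAverage_eq_average {ξ : Ordinal.{u}} (f : piSet (omegaTree ξ D) → ℝ)
    (t : maxSet (omegaTree ξ D)) :
    branchAverage f t =
      average ξ (fun s => if h : (s, t.1) ∈ piSet (omegaTree ξ D) then f ⟨_, h⟩ else 0) t.1 := by
  have hlen : ∀ s : {s : omegaTree ξ D // s.1 <+: t.1}, 0 < s.1.1.length := fun s =>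
    List.length_pos_of_ne_nil (omegaTree_ne_nil s.1.2)
  have htake : ∀ s : {s : omegaTree ξ D // s.1 <+: t.1},
      t.1.take (s.1.1.length - 1 + 1) = s.1.1 := fun s => by
    rw [Nat.sub_add_cancel (hlen s), ← List.prefix_iff_eq_take.1 s.2]
  rw [branchAverage, average]
  refine Finset.sum_of_injOn (fun s => s.1.1.length - 1) ?_ ?_ ?_ ?_
  · intro s _ s' _ h
    refine Subtype.ext (Subtype.ext ?_)
    rw [← htake s, ← htake s']
    exact congrArg (fun k => t.1.take (k + 1)) h
  · intro s _
    have := hlen s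
    have := s.2.length_le
    simp only [Finset.coe_range, Set.mem_Iio]
    omega
  · intro k hk hnot
    by_cases hm : t.1.take (k + 1) ∈ omegaTree ξ D
    · refine absurd ⟨⟨⟨_, hm⟩, List.take_prefix _ _⟩, Finset.mem_coe.2 (Finset.mem_univ _), ?_⟩ hnot
      have := Finset.mem_range.1 hk
      simp only [List.length_take]
      omega
    · rw [treeWeight, dif_neg hm, zero_mul]
  · intro s _
    have hp : (s.1.1, t.1) ∈ piSet (omegaTree ξ D) := ⟨s.1.2, t.2, s.2⟩
    simp only [htake s]
    rw [treeWeight, dif_pos s.1.2, dif_pos hp]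

end Average
open Filter Topology

/-! ### Limits of bounded functions along ultrafilters -/

section Ulim

variable {α β : Type*}

/-- The limit of a real function along an ultrafilter on which it is bounded. -/
noncomputable def ulim (V : Ultrafilter α) (f : α → ℝ) : ℝ :=
  limUnder (V : Filter α) f

/-- Compactness of `[-C, C]`. The bound is asked only on a member of `V`, because averages are
controlled on branches only. -/
theorem tendsto_ulim {V : Ultrafilter α} {f : α → ℝ} {C : ℝ} (h : ∀ᶠ x in V, |f x| ≤ C) :
    Tendsto f V (𝓝 (ulim V f)) := by
  refine tendsto_nhds_limUnder ?_
  have hc : IsCompact (Set.Icc (-C) C) := isCompact_Icc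
  obtain ⟨x, -, hx⟩ := hc.ultrafilter_le_nhds (V.map f)
    (le_principal_iff.2 (h.mono fun x hx => abs_le.1 hx))
  exact ⟨x, hx⟩

theorem ulim_eq {V : Ultrafilter α} {f : α → ℝ} {x : ℝ} (h : Tendsto f V (𝓝 x)) : ulim V f = x :=
  h.limUnder_eq

theorem ulim_congr {V : Ultrafilter α} {f g : α → ℝ} {C : ℝ} (h : ∀ᶠ x in V, |g x| ≤ C)
    (hfg : ∀ᶠ x in V, f x = g x) : ulim V f = ulim V g :=
  ulim_eq ((tendsto_ulim h).congr' (hfg.mono fun _ hx => hx.symm))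

theorem ulim_le {V : Ultrafilter α} {f : α → ℝ} {C b : ℝ} (h : ∀ᶠ x in V, |f x| ≤ C)
    (hb : ∀ᶠ x in V, f x ≤ b) : ulim V f ≤ b :=
  le_of_tendsto (tendsto_ulim h) hb

theorem le_ulim {V : Ultrafilter α} {f : α → ℝ} {C b : ℝ} (h : ∀ᶠ x in V, |f x| ≤ C)
    (hb : ∀ᶠ x in V, b ≤ f x) : b ≤ ulim V f :=
  ge_of_tendsto (tendsto_ulim h) hb

theorem abs_ulim_le {V : Ultrafilter α} {f : α → ℝ} {C : ℝ} (h : ∀ᶠ x in V, |f x| ≤ C) :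
    |ulim V f| ≤ C :=
  abs_le.2 ⟨le_ulim h (h.mono fun _ hx => (abs_le.1 hx).1),
    ulim_le h (h.mono fun _ hx => (abs_le.1 hx).2)⟩

theorem eventually_lt_of_lt_ulim {V : Ultrafilter α} {f : α → ℝ} {C c : ℝ}
    (h : ∀ᶠ x in V, |f x| ≤ C) (hc : c < ulim V f) : ∀ᶠ x in V, c < f x :=
  (tendsto_ulim h).eventually_const_lt hc

theorem ulim_map (V : Ultrafilter α) (φ : α → β) (f : β → ℝ) :
    ulim (V.map φ) f = ulim V (fun x => f (φ x)) := by
  rw [ulim, ulim, limUnder, limUnder, Ultrafilter.coe_map, Filter.map_map]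
  rfl

theorem eventually_bind {V : Ultrafilter α} {W : α → Ultrafilter β} {p : β → Prop} :
    (∀ᶠ y in V.bind W, p y) ↔ ∀ᶠ x in V, ∀ᶠ y in W x, p y :=
  Iff.rfl

theorem ulim_bind {V : Ultrafilter α} {W : α → Ultrafilter β} {f : β → ℝ} {C : ℝ}
    (h : ∀ᶠ y in V.bind W, |f y| ≤ C) : ulim (V.bind W) f = ulim V (fun x => ulim (W x) f) := by
  have h' : ∀ᶠ x in V, |ulim (W x) f| ≤ C := (eventually_bind.1 h).mono fun x hx => abs_ulim_le hx
  refine tendsto_nhds_unique ?_ (tendsto_ulim h')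
  refine Metric.tendsto_nhds.2 fun ε hε => ?_
  have h1 := Metric.tendsto_nhds.1 (tendsto_ulim h) (ε / 2) (half_pos hε)
  filter_upwards [eventually_bind.1 h1, eventually_bind.1 h] with x hx hx'
  have h2 := Metric.tendsto_nhds.1 (tendsto_ulim hx') (ε / 2) (half_pos hε)
  -- One `y` at which `f` is close both to the inner limit at `x` and to the limit along `V.bind W`.
  obtain ⟨y, hy, hy'⟩ := (hx.and h2).exists
  calc dist (ulim (W x) f) (ulim (V.bind W) f)
      ≤ dist (ulim (W x) f) (f y) + dist (f y) (ulim (V.bind W) f) := dist_triangle _ _ _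
    _ < ε / 2 + ε / 2 := add_lt_add (by rwa [dist_comm]) hy
    _ = ε := add_halves ε

theorem ulim_average {D : Type v} {V : Ultrafilter α} {ξ : Ordinal.{u}}
    {F : α → List (Ordinal.{u} × D) → ℝ} {C : ℝ} (hF : ∀ x s, |F x s| ≤ C)
    (t : List (Ordinal.{u} × D)) :
    Tendsto (fun x => average ξ (F x) t) V (𝓝 (average ξ (fun s => ulim V fun x => F x s) t)) := by
  refine tendsto_finsetSum _ fun k _ => Tendsto.const_mul _ ?_
  exact tendsto_ulim (Eventually.of_forall fun x => hF x _)

end Ulim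

/-! ### Prunings -/

section Pruning

variable {Λ D : Type*} [LE D]

/-- The last second coordinate of `s` is at most that of `t`. -/
def LastLE {Λ Λ' : Type*} (s : List (Λ × D)) (t : List (Λ' × D)) : Prop :=
  ∀ U ∈ (s.map Prod.snd).getLast?, ∀ U' ∈ (t.map Prod.snd).getLast?, U ≤ U'

/-- `(θ, e)` acts as an extended pruning of the tree `S` with branches `M` into the tree `S'`, it
sends branches into `B`, and it moves `g` above `c`. -/
structure IsPruning (S M S' B : Set (List (Λ × D))) (g : List (Λ × D) → List (Λ × D) → ℝ) (c : ℝ)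
    (θ e : List (Λ × D) → List (Λ × D)) : Prop where
  maps : ∀ s ∈ S, θ s ∈ S'
  mono : ∀ s ∈ S, ∀ t ∈ S, Prec s t → Prec (θ s) (θ t)
  last : ∀ s ∈ S, LastLE s (θ s)
  branch : ∀ t ∈ M, e t ∈ B
  pre : ∀ s ∈ S, ∀ t ∈ M, s <+: t → θ s <+: e t
  large : ∀ s ∈ S, ∀ t ∈ M, s <+: t → c ≤ g (θ s) (e t)

/-- There is an extended pruning of `S` (with branches `M`) into `S'` which sends branches into `B`
and moves `g` above `c`. -/
def Prunable (S M S' B : Set (List (Λ × D))) (g : List (Λ × D) → List (Λ × D) → ℝ) (c : ℝ) : Prop :=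
  ∃ θ e, IsPruning S M S' B g c θ e

variable {S M S' M' S'' B B' : Set (List (Λ × D))} {g : List (Λ × D) → List (Λ × D) → ℝ} {c c' : ℝ}

theorem Prunable.mono (h : Prunable S M S' B g c) (hS : S' ⊆ S'') (hB : B ⊆ B') (hc : c' ≤ c) :
    Prunable S M S'' B' g c' := by
  obtain ⟨θ, e, h⟩ := h
  exact ⟨θ, e, fun s hs => hS (h.maps s hs), h.mono, h.last, fun t ht => hB (h.branch t ht), h.pre,
    fun s hs t ht hst => hc.trans (h.large s hs t ht hst)⟩

theorem exists_mem_getLast? {α : Type*} {l : List α} (h : l ≠ []) : ∃ x, x ∈ l.getLast? :=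
  ⟨_, List.getLast?_eq_some_getLast h⟩

end Pruning

section PruningPreorder

variable {Λ D : Type*} [Preorder D]
  {S M S' M' S'' B : Set (List (Λ × D))} {g : List (Λ × D) → List (Λ × D) → ℝ} {c : ℝ}

theorem LastLE.refl (s : List (Λ × D)) : LastLE s s := fun U hU U' hU' => by
  rw [Option.mem_unique hU hU']

/-- `LastLE` holds vacuously when a sequence is empty, so the middle one must not be. -/
theorem LastLE.trans {r s t : List (Λ × D)} (h : LastLE r s) (h' : LastLE s t) (hs : s ≠ []) :
    LastLE r t := by
  intro U hU U' hU'
  obtain ⟨x, hx⟩ := exists_mem_getLast? (l := s.map Prod.snd) (by simpa using hs)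
  exact (h U hU x hx).trans (h' x hx U' hU')

theorem LastLE.append {s t : List (Λ × D)} (h : LastLE s t) (a b : List (Λ × D)) (hs : s ≠ [])
    (ht : t ≠ []) : LastLE (a ++ s) (b ++ t) := by
  unfold LastLE
  rw [List.map_append, List.map_append, List.getLast?_append_of_ne_nil _ (by simpa using hs),
    List.getLast?_append_of_ne_nil _ (by simpa using ht)]
  exact h

/-- With the function `0` and the bound `0` the size condition is void, and `Prunable` only speaks
of an extended pruning. -/
theorem Prunable.refl (S M : Set (List (Λ × D))) : Prunable S M S M (fun _ _ => 0) 0 :=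
  ⟨id, id, fun _ => id, fun _ _ _ _ => id, fun s _ => LastLE.refl s, fun _ => id,
    fun _ _ _ _ => id, fun _ _ _ _ _ => le_rfl⟩

theorem Prunable.trans (h : Prunable S M S' M' (fun _ _ => 0) 0) (h' : Prunable S' M' S'' B g c)
    (hS' : [] ∉ S') : Prunable S M S'' B g c := by
  obtain ⟨θ, e, h⟩ := h
  obtain ⟨θ', e', h'⟩ := h'
  refine ⟨fun s => θ' (θ s), fun t => e' (e t), fun s hs => h'.maps _ (h.maps s hs), ?_, ?_,
    fun t ht => h'.branch _ (h.branch t ht), ?_, ?_⟩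
  · exact fun s hs t ht hst => h'.mono _ (h.maps s hs) _ (h.maps t ht) (h.mono s hs t ht hst)
  · refine fun s hs => (h.last s hs).trans (h'.last _ (h.maps s hs)) ?_
    exact fun h0 => hS' (h0 ▸ h.maps s hs)
  · exact fun s hs t ht hst => h'.pre _ (h.maps s hs) _ (h.branch t ht) (h.pre s hs t ht hst)
  · exact fun s hs t ht hst => h'.large _ (h.maps s hs) _ (h.branch t ht) (h.pre s hs t ht hst)

/-- Prunings of the members of a disjoint union of trees form a pruning of the union. -/
theorem Prunable.iUnion {ι : Type*} {S M : ι → Set (List (Λ × D))}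
    (hS : ∀ i j s t, s ∈ S i → t ∈ S j → s <+: t → i = j) (hM : ∀ i, M i ⊆ S i)
    (h : ∀ i, Prunable (S i) (M i) S' B g c) : Prunable (⋃ i, S i) (⋃ i, M i) S' B g c := by
  classical
  choose θ e h using h
  have hidx : ∃ idx : List (Λ × D) → Option ι, ∀ i, ∀ s ∈ S i, idx s = some i := by
    refine ⟨fun s => if h : ∃ i, s ∈ S i then some h.choose else none, fun i s hs => ?_⟩
    have hex : ∃ i, s ∈ S i := ⟨i, hs⟩
    simp only [dif_pos hex]
    exact congrArg some (hS _ _ _ _ hex.choose_spec hs List.prefix_rfl)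
  obtain ⟨idx, hidx⟩ := hidx
  refine ⟨fun s => ((idx s).map fun i => θ i s).getD [], fun s => ((idx s).map fun i => e i s).getD [],
    ?_, ?_, ?_, ?_, ?_, ?_⟩
  · intro s hs
    obtain ⟨i, hs⟩ := Set.mem_iUnion.1 hs
    simpa [hidx i s hs] using (h i).maps s hs
  · intro s hs t ht hst
    obtain ⟨i, hs⟩ := Set.mem_iUnion.1 hs
    obtain ⟨j, ht⟩ := Set.mem_iUnion.1 ht
    obtain rfl := hS i j s t hs ht hst.1
    simpa [hidx i s hs, hidx i t ht] using (h i).mono s hs t ht hst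
  · intro s hs
    obtain ⟨i, hs⟩ := Set.mem_iUnion.1 hs
    simpa [hidx i s hs] using (h i).last s hs
  · intro t ht
    obtain ⟨i, ht⟩ := Set.mem_iUnion.1 ht
    simpa [hidx i t (hM i ht)] using (h i).branch t ht
  · intro s hs t ht hst
    obtain ⟨i, hs⟩ := Set.mem_iUnion.1 hs
    obtain ⟨j, ht⟩ := Set.mem_iUnion.1 ht
    obtain rfl := hS i j s t hs (hM j ht) hst
    simpa [hidx i s hs, hidx i t (hM i ht)] using (h i).pre s hs t ht hst
  · intro s hs t ht hst
    obtain ⟨i, hs⟩ := Set.mem_iUnion.1 hs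
    obtain ⟨j, ht⟩ := Set.mem_iUnion.1 ht
    obtain rfl := hS i j s t hs (hM j ht) hst
    simpa [hidx i s hs, hidx i t (hM i ht)] using (h i).large s hs t ht hst

end PruningPreorder

/-- The sequence from which a translate arises. -/
noncomputable def unshiftDir {D : Type v} (ζ : Ordinal.{u}) :
    List (Ordinal.{u} × D) → List (Ordinal.{u} × D) :=
  Function.invFun (shiftDir ζ)

theorem unshiftDir_shiftDir {D : Type v} (ζ : Ordinal.{u}) (s : List (Ordinal.{u} × D)) :
    unshiftDir ζ (shiftDir ζ s) = s :=
  Function.leftInverse_invFun (shiftDir_injective ζ) s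


/-! ### Prunings of translated and prolonged trees -/

section PruningShift

variable {D : Type v} [Preorder D] {S M S' B : Set (List (Ordinal.{u} × D))}
  {g : List (Ordinal.{u} × D) → List (Ordinal.{u} × D) → ℝ} {c : ℝ}

theorem LastLE.shift {s t : List (Ordinal.{u} × D)} (h : LastLE s t) (ζ η : Ordinal.{u}) :
    LastLE (shiftDir ζ s) (shiftDir η t) := by
  unfold LastLE
  rw [map_snd_shiftDir, map_snd_shiftDir]
  exact h

theorem Prunable.shift_source (h : Prunable S M S' B g c) (ζ : Ordinal.{u}) :
    Prunable (shiftDir ζ '' S) (shiftDir ζ '' M) S' B g c := by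
  obtain ⟨θ, e, h⟩ := h
  refine ⟨fun s => θ (unshiftDir ζ s), fun s => e (unshiftDir ζ s), ?_, ?_, ?_, ?_, ?_, ?_⟩
  · rintro _ ⟨s, hs, rfl⟩
    simpa [unshiftDir_shiftDir] using h.maps s hs
  · rintro _ ⟨s, hs, rfl⟩ _ ⟨t, ht, rfl⟩ hst
    simpa [unshiftDir_shiftDir] using h.mono s hs t ht ((shiftDir_prec_iff _ _ _).1 hst)
  · rintro _ ⟨s, hs, rfl⟩
    have := (h.last s hs).shift ζ 0
    rw [shiftDir_zero] at this
    simpa [unshiftDir_shiftDir] using this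
  · rintro _ ⟨t, ht, rfl⟩
    simpa [unshiftDir_shiftDir] using h.branch t ht
  · rintro _ ⟨s, hs, rfl⟩ _ ⟨t, ht, rfl⟩ hst
    simpa [unshiftDir_shiftDir] using h.pre s hs t ht ((shiftDir_prefix_iff _ _ _).1 hst)
  · rintro _ ⟨s, hs, rfl⟩ _ ⟨t, ht, rfl⟩ hst
    simpa [unshiftDir_shiftDir] using h.large s hs t ht ((shiftDir_prefix_iff _ _ _).1 hst)

theorem Prunable.shift_target {ζ : Ordinal.{u}}
    (h : Prunable S M S' {t | shiftDir ζ t ∈ B} (fun s t => g (shiftDir ζ s) (shiftDir ζ t)) c) :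
    Prunable S M (shiftDir ζ '' S') B g c := by
  obtain ⟨θ, e, h⟩ := h
  refine ⟨fun s => shiftDir ζ (θ s), fun t => shiftDir ζ (e t),
    fun s hs => ⟨_, h.maps s hs, rfl⟩, ?_, ?_, h.branch, ?_, h.large⟩
  · exact fun s hs t ht hst => (shiftDir_prec_iff _ _ _).2 (h.mono s hs t ht hst)
  · intro s hs
    have := (h.last s hs).shift 0 ζ
    rwa [shiftDir_zero] at this
  · exact fun s hs t ht hst => (shiftDir_prefix_iff _ _ _).2 (h.pre s hs t ht hst)

theorem Prunable.append_target (a : List (Ordinal.{u} × D))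
    (h : Prunable S M S' {t | a ++ t ∈ B} (fun s t => g (a ++ s) (a ++ t)) c)
    (hS : [] ∉ S) (hS' : [] ∉ S') : Prunable S M ((a ++ ·) '' S') B g c := by
  obtain ⟨θ, e, h⟩ := h
  refine ⟨fun s => a ++ θ s, fun t => a ++ e t,
    fun s hs => ⟨_, h.maps s hs, rfl⟩, ?_, ?_, h.branch, ?_, h.large⟩
  · exact fun s hs t ht hst => (prec_append_iff _ _ _).2 (h.mono s hs t ht hst)
  · intro s hs
    exact (h.last s hs).append [] a (fun h0 => hS (h0 ▸ hs)) (fun h0 => hS' (h0 ▸ h.maps s hs))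
  · exact fun s hs t ht hst => (List.prefix_append_right_inj _).2 (h.pre s hs t ht hst)

end PruningShift

/-! ### Grafting prunings block by block -/

section Graft

variable {D : Type v}

/-- Splitting off the first block of a sequence in `Γ_{ξ,n} D`. -/
theorem exists_split (ξ c : Ordinal.{u}) : ∃ p : List (Ordinal.{u} × D) →
    List (Ordinal.{u} × D) × List (Ordinal.{u} × D),
    (∀ a ∈ omegaTree ξ D, p (shiftDir c a) = (a, [])) ∧
    ∀ t ∈ maxSet (omegaTree ξ D), ∀ v, p (shiftDir c t ++ v) = (t, v) := by
  classical
  let P : List (Ordinal.{u} × D) → List (Ordinal.{u} × D) × List (Ordinal.{u} × D) → Prop :=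
    fun s q => q.1 ∈ maxSet (omegaTree ξ D) ∧ s = shiftDir c q.1 ++ q.2
  have hshift : ∀ t ∈ maxSet (omegaTree ξ D),
      shiftDir c t ∈ maxSet (shiftDir c '' omegaTree ξ D) := by
    intro t ht
    rw [maxSet_shiftDir]
    exact ⟨t, ht, rfl⟩
  have hP : ∀ t ∈ maxSet (omegaTree ξ D), ∀ v q, P (shiftDir c t ++ v) q → q = (t, v) := by
    rintro t ht v ⟨q₁, q₂⟩ ⟨hq, he⟩
    obtain ⟨h1, h2⟩ := append_inj_of_mem_maxSet (hshift t ht) (hshift q₁ hq) he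
    rw [shiftDir_injective c h1, h2]
  let p : List (Ordinal.{u} × D) → List (Ordinal.{u} × D) × List (Ordinal.{u} × D) :=
    fun s => if h : ∃ q, P s q then h.choose else (unshiftDir c s, [])
  have hp : ∀ t ∈ maxSet (omegaTree ξ D), ∀ v, p (shiftDir c t ++ v) = (t, v) := by
    intro t ht v
    have h : ∃ q, P (shiftDir c t ++ v) q := ⟨(t, v), ht, rfl⟩
    simp only [p, dif_pos h]
    exact hP t ht v _ h.choose_spec
  refine ⟨p, fun a ha => ?_, hp⟩
  by_cases h : ∃ q, P (shiftDir c a) q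
  · obtain ⟨⟨t, v⟩, ht, he⟩ := h
    have h1 : t <+: a := (shiftDir_prefix_iff c _ _).1 (he ▸ List.prefix_append _ v)
    obtain rfl := eq_of_prefix_of_mem_maxSet ht ha h1
    simpa using hp t ht []
  · simp only [p, dif_neg h, unshiftDir_shiftDir]

variable [Preorder D] [Nonempty D]

/-- Within the first block `θ₁` acts; beyond a complete first block `t` the image continues from `e₁
t`, which extends `θ₁ t`, by a pruning chosen for that `t`. The inequality for pairs with `s` in the
first block involves the whole image branch, so it is imposed on the branches `v` of the second
pruning. -/
theorem Prunable.graft {ξ : Ordinal.{u}} {m n : ℕ} {B : Set (List (Ordinal.{u} × D))}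
    {g g₁ : List (Ordinal.{u} × D) → List (Ordinal.{u} × D) → ℝ} {c c₁ : ℝ}
    {θ₁ e₁ : List (Ordinal.{u} × D) → List (Ordinal.{u} × D)}
    (h₁ : IsPruning (omegaTree ξ D) (maxSet (omegaTree ξ D)) (omegaTree ξ D)
      (maxSet (omegaTree ξ D)) g₁ c₁ θ₁ e₁)
    (h₂ : ∀ t ∈ maxSet (omegaTree ξ D), Prunable (blockTree ξ D m) (blockBranch ξ D m)
      (blockTree ξ D n)
      {v | shiftDir (ω ^ ξ * n) (e₁ t) ++ v ∈ B ∧ ∀ s ∈ omegaTree ξ D, s <+: t →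
        c ≤ g (shiftDir (ω ^ ξ * n) (θ₁ s)) (shiftDir (ω ^ ξ * n) (e₁ t) ++ v)}
      (fun s v => g (shiftDir (ω ^ ξ * n) (e₁ t) ++ s) (shiftDir (ω ^ ξ * n) (e₁ t) ++ v)) c) :
    Prunable (blockTree ξ D (m + 1)) (blockBranch ξ D (m + 1)) (blockTree ξ D (n + 1)) B g c := by
  classical
  have h₂' : ∀ t, ∃ θ e, t ∈ maxSet (omegaTree ξ D) → IsPruning (blockTree ξ D m)
      (blockBranch ξ D m) (blockTree ξ D n)
      {v | shiftDir (ω ^ ξ * n) (e₁ t) ++ v ∈ B ∧ ∀ s ∈ omegaTree ξ D, s <+: t →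
        c ≤ g (shiftDir (ω ^ ξ * n) (θ₁ s)) (shiftDir (ω ^ ξ * n) (e₁ t) ++ v)}
      (fun s v => g (shiftDir (ω ^ ξ * n) (e₁ t) ++ s) (shiftDir (ω ^ ξ * n) (e₁ t) ++ v)) c θ e := by
    intro t
    by_cases ht : t ∈ maxSet (omegaTree ξ D)
    · obtain ⟨θ, e, h⟩ := h₂ t ht
      exact ⟨θ, e, fun _ => h⟩
    · exact ⟨id, id, fun h => absurd h ht⟩
  choose θ₂ e₂ h₂ using h₂'
  obtain ⟨p, hp, hp'⟩ := exists_split (D := D) ξ (ω ^ ξ * m)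
  let θ : List (Ordinal.{u} × D) → List (Ordinal.{u} × D) := fun s =>
    if (p s).2 = [] then shiftDir (ω ^ ξ * n) (θ₁ (p s).1)
    else shiftDir (ω ^ ξ * n) (e₁ (p s).1) ++ θ₂ (p s).1 (p s).2
  have hθ : ∀ a ∈ omegaTree ξ D, θ (shiftDir (ω ^ ξ * m) a) = shiftDir (ω ^ ξ * n) (θ₁ a) := by
    intro a ha
    simp only [θ, hp a ha, if_true]
  have hθ' : ∀ t ∈ maxSet (omegaTree ξ D), ∀ v ∈ blockTree ξ D m,
      θ (shiftDir (ω ^ ξ * m) t ++ v) = shiftDir (ω ^ ξ * n) (e₁ t) ++ θ₂ t v := by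
    intro t ht v hv
    simp only [θ, hp' t ht v, if_neg (blockTree_ne_nil hv)]
  have hmax : ∀ a ∈ omegaTree ξ D, ∀ t ∈ maxSet (omegaTree ξ D), ∀ v,
      shiftDir (ω ^ ξ * m) a <+: shiftDir (ω ^ ξ * m) t ++ v → a <+: t := by
    intro a ha t ht v h
    have ht' : shiftDir (ω ^ ξ * m) t ∈ maxSet (shiftDir (ω ^ ξ * m) '' omegaTree ξ D) := by
      rw [maxSet_shiftDir]
      exact ⟨t, ht, rfl⟩
    exact (shiftDir_prefix_iff _ _ _).1
      (prefix_of_mem_maxSet ht' ⟨a, ha, rfl⟩ (List.prefix_append _ v) h)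
  have hmax' : ∀ t ∈ maxSet (omegaTree ξ D), ∀ t' ∈ maxSet (omegaTree ξ D), ∀ v v',
      shiftDir (ω ^ ξ * m) t ++ v <+: shiftDir (ω ^ ξ * m) t' ++ v' → t = t' := by
    intro t ht t' ht' v v' h
    exact eq_of_prefix_of_mem_maxSet ht ht'.1
      (hmax t ht.1 t' ht' v' ((List.prefix_append _ v).trans h))
  refine ⟨θ, fun s => shiftDir (ω ^ ξ * n) (e₁ (p s).1) ++ e₂ (p s).1 (p s).2,
    ?_, ?_, ?_, ?_, ?_, ?_⟩
  · intro s hs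
    rcases mem_blockTree_succ.1 hs with ⟨a, ha, rfl⟩ | ⟨t, ht, v, hv, rfl⟩
    · rw [hθ a ha]
      exact mem_blockTree_succ.2 (Or.inl ⟨_, h₁.maps a ha, rfl⟩)
    · rw [hθ' t ht v hv]
      exact mem_blockTree_succ.2 (Or.inr ⟨_, h₁.branch t ht, _, (h₂ t ht).maps v hv, rfl⟩)
  · intro s hs s' hs' hss
    rcases mem_blockTree_succ.1 hs with ⟨a, ha, rfl⟩ | ⟨t, ht, v, hv, rfl⟩
    · rcases mem_blockTree_succ.1 hs' with ⟨a', ha', rfl⟩ | ⟨t', ht', v', hv', rfl⟩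
      · rw [hθ a ha, hθ a' ha', shiftDir_prec_iff]
        exact h₁.mono a ha a' ha' ((shiftDir_prec_iff _ _ _).1 hss)
      · rw [hθ a ha, hθ' t' ht' v' hv']
        have h := (shiftDir_prefix_iff (ω ^ ξ * n) _ _).2
          (h₁.pre a ha t' ht' (hmax a ha t' ht' v' hss.1))
        refine ⟨h.trans (List.prefix_append _ _), fun he => ?_⟩
        have h3 := List.length_pos_of_ne_nil (blockTree_ne_nil ((h₂ t' ht').maps v' hv'))
        have h4 := h.length_le
        rw [he, List.length_append] at h4
        omega
    · rcases mem_blockTree_succ.1 hs' with ⟨a', ha', rfl⟩ | ⟨t', ht', v', hv', rfl⟩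
      · have h := (shiftDir_prefix_iff _ _ _).1 ((List.prefix_append _ v).trans hss.1)
        obtain rfl := eq_of_prefix_of_mem_maxSet ht ha' h
        exact absurd hss.length_lt (by simp)
      · obtain rfl := hmax' t ht t' ht' v v' hss.1
        rw [hθ' t ht v hv, hθ' t ht v' hv', prec_append_iff]
        exact (h₂ t ht).mono v hv v' hv' ((prec_append_iff _ _ _).1 hss)
  · intro s hs
    rcases mem_blockTree_succ.1 hs with ⟨a, ha, rfl⟩ | ⟨t, ht, v, hv, rfl⟩
    · rw [hθ a ha]
      exact (h₁.last a ha).shift _ _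
    · rw [hθ' t ht v hv]
      exact ((h₂ t ht).last v hv).append _ _ (blockTree_ne_nil hv)
        (blockTree_ne_nil ((h₂ t ht).maps v hv))
  · rintro _ ⟨t, ht, v, hv, rfl⟩
    simp only [hp' t ht v]
    exact ((h₂ t ht).branch v hv).1
  · rintro s hs _ ⟨t', ht', v', hv', rfl⟩ hst
    simp only [hp' t' ht' v']
    rcases mem_blockTree_succ.1 hs with ⟨a, ha, rfl⟩ | ⟨t, ht, v, hv, rfl⟩
    · rw [hθ a ha]
      exact ((shiftDir_prefix_iff _ _ _).2
        (h₁.pre a ha t' ht' (hmax a ha t' ht' v' hst))).trans (List.prefix_append _ _)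
    · obtain rfl := hmax' t ht t' ht' v v' hst
      rw [hθ' t ht v hv, List.prefix_append_right_inj]
      exact (h₂ t ht).pre v hv v' hv' ((List.prefix_append_right_inj _).1 hst)
  · rintro s hs _ ⟨t', ht', v', hv', rfl⟩ hst
    simp only [hp' t' ht' v']
    rcases mem_blockTree_succ.1 hs with ⟨a, ha, rfl⟩ | ⟨t, ht, v, hv, rfl⟩
    · rw [hθ a ha]
      exact ((h₂ t' ht').branch v' hv').2 a ha (hmax a ha t' ht' v' hst)
    · obtain rfl := hmax' t ht t' ht' v v' hst
      rw [hθ' t ht v hv]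
      exact (h₂ t ht).large v hv v' hv' ((List.prefix_append_right_inj _).1 hst)

end Graft

/-! ### Comparison of the trees for different ordinals -/

section Embedding

variable {D : Type v}

theorem nil_notMem_omegaTree (ξ : Ordinal.{u}) : [] ∉ omegaTree ξ D :=
  fun h => omegaTree_ne_nil h rfl

theorem nil_notMem_blockTree (ξ : Ordinal.{u}) (n : ℕ) : [] ∉ blockTree ξ D n :=
  fun h => blockTree_ne_nil h rfl

theorem blockTree_one (ξ : Ordinal.{u}) : blockTree ξ D 1 = omegaTree ξ D := by
  rw [blockTree, gammaN_one]

theorem blockBranch_subset_maxSet [Nonempty D] (ξ : Ordinal.{u}) {n : ℕ} (hn : n ≠ 0) :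
    blockBranch ξ D n ⊆ maxSet (omegaTree (ξ + 1) D) := by
  obtain ⟨n, rfl⟩ := Nat.exists_eq_succ_of_ne_zero hn
  rw [maxSet_omegaTree_succ (maxSet_omegaTree_nonempty ξ)]
  exact Set.subset_iUnion (fun n => blockBranch ξ D (n + 1)) n

variable [Preorder D] [Nonempty D]

/-- The trees `Γ_ζ D` increase with `ζ`, up to prunings. -/
theorem prunable_omegaTree_of_le {ζ ξ : Ordinal.{u}} (h : ζ ≤ ξ) :
    Prunable (omegaTree ζ D) (maxSet (omegaTree ζ D)) (omegaTree ξ D) (maxSet (omegaTree ξ D))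
      (fun _ _ => 0) 0 := by
  -- `Γ_η = Γ_{η,1}` is one of the pieces of `Γ_{η+1}`, so the identity is a pruning.
  have hstep : ∀ η : Ordinal.{u}, Prunable (omegaTree η D) (maxSet (omegaTree η D))
      (omegaTree (η + 1) D) (maxSet (omegaTree (η + 1) D)) (fun _ _ => 0) 0 := by
    intro η
    refine (Prunable.refl _ _).mono ?_ ?_ le_rfl
    · rw [← blockTree_one]
      exact blockTree_subset η 1
    · rw [← blockTree_one, maxSet_blockTree_succ (maxSet_omegaTree_nonempty η) 0]
      exact blockBranch_subset_maxSet η one_ne_zero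
  induction ξ using Ordinal.limitRecOn with
  | zero =>
    obtain rfl : ζ = 0 := by simpa using h
    exact Prunable.refl _ _
  | add_one ξ ih =>
    rcases h.eq_or_lt with rfl | hlt
    · exact Prunable.refl _ _
    · exact (ih (Order.le_of_lt_add_one hlt)).trans (hstep ξ) (nil_notMem_omegaTree ξ)
  | limit ξ hξ ih =>
    rcases h.eq_or_lt with rfl | hlt
    · exact Prunable.refl _ _
    · refine (hstep ζ).trans ?_ (nil_notMem_omegaTree _)
      refine (Prunable.shift_target (ζ := ω ^ ζ) (B := maxSet (omegaTree ξ D))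
        (g := fun _ _ => 0) ((Prunable.refl _ _).mono subset_rfl ?_ le_rfl)).mono ?_ subset_rfl le_rfl
      · intro t ht
        rw [Set.mem_ofPred_eq, maxSet_omegaTree_limit hξ]
        exact Set.mem_iUnion.2 ⟨⟨ζ, hlt⟩, t, ht, rfl⟩
      · rw [omegaTree_limit hξ]
        exact Set.subset_iUnion (fun η : Set.Iio ξ => shiftDir (ω ^ η.1) '' omegaTree (η.1 + 1) D)
          ⟨ζ, hlt⟩

end Embedding

/-! ### Averaging ultrafilters -/

section Averaging

variable {D : Type v}

/-- The ultrafilter on concatenations of `n` blocks obtained from an ultrafilter on blocks. -/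
noncomputable def blockUltra (ξ : Ordinal.{u}) (V : Ultrafilter (List (Ordinal.{u} × D))) :
    ℕ → Ultrafilter (List (Ordinal.{u} × D))
  | 0 => pure []
  | n + 1 => V.bind fun t => (blockUltra ξ V n).map fun v => shiftDir (ω ^ ξ * n) t ++ v

theorem eventually_blockUltra_succ {ξ : Ordinal.{u}} {V : Ultrafilter (List (Ordinal.{u} × D))}
    {n : ℕ} {p : List (Ordinal.{u} × D) → Prop} :
    (∀ᶠ t in blockUltra ξ V (n + 1), p t) ↔
      ∀ᶠ t in V, ∀ᶠ v in blockUltra ξ V n, p (shiftDir (ω ^ ξ * n) t ++ v) :=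
  Iff.rfl

theorem eventually_mem_blockBranch {ξ : Ordinal.{u}} {V : Ultrafilter (List (Ordinal.{u} × D))}
    (hV : ∀ᶠ t in V, t ∈ maxSet (omegaTree ξ D)) (n : ℕ) :
    ∀ᶠ t in blockUltra ξ V n, t ∈ blockBranch ξ D n := by
  induction n with
  | zero => exact Filter.mem_pure.2 rfl
  | succ n ih =>
    rw [eventually_blockUltra_succ]
    filter_upwards [hV] with t ht
    filter_upwards [ih] with v hv
    exact ⟨t, ht, v, hv, rfl⟩

theorem abs_block_average_le [Nonempty D] {ξ : Ordinal.{u}} {n : ℕ}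
    {F : List (Ordinal.{u} × D) → ℝ} {C : ℝ} (hF : ∀ s, |F s| ≤ C) {t : List (Ordinal.{u} × D)}
    (ht : t ∈ blockBranch ξ D n) : |n * average (ξ + 1) F t| ≤ n * C := by
  by_cases hn : n = 0
  · simp [hn]
  · rw [abs_mul, Nat.abs_cast]
    exact mul_le_mul_of_nonneg_left (abs_average_le hF (blockBranch_subset_maxSet ξ hn ht))
      (Nat.cast_nonneg n)

section BlockSum

variable [Nonempty D] {ξ : Ordinal.{u}} {V : Ultrafilter (List (Ordinal.{u} × D))}
  {g : List (Ordinal.{u} × D) → List (Ordinal.{u} × D) → ℝ} {C : ℝ}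

/-- The limit of the sums over `n` blocks of the averages of `g`. -/
noncomputable def blockSum (ξ : Ordinal.{u}) (V : Ultrafilter (List (Ordinal.{u} × D))) (n : ℕ)
    (g : List (Ordinal.{u} × D) → List (Ordinal.{u} × D) → ℝ) : ℝ :=
  ulim (blockUltra ξ V n) fun t => n * average (ξ + 1) (fun s => g s t) t

theorem eventually_abs_block_average_le (hV : ∀ᶠ t in V, t ∈ maxSet (omegaTree ξ D))
    (hg : ∀ s t, |g s t| ≤ C) (n : ℕ) :
    ∀ᶠ t in blockUltra ξ V n, |n * average (ξ + 1) (fun s => g s t) t| ≤ n * C :=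
  (eventually_mem_blockBranch hV n).mono fun t ht => abs_block_average_le (fun s => hg s t) ht

/-- `blockSum` splits into the contribution of the first block and that of the other ones. -/
theorem blockSum_succ (hV : ∀ᶠ t in V, t ∈ maxSet (omegaTree ξ D)) (hg : ∀ s t, |g s t| ≤ C)
    (n : ℕ) :
    blockSum ξ V (n + 1) g =
      ulim V (fun t => average ξ (fun s => ulim (blockUltra ξ V n) fun v =>
        g (shiftDir (ω ^ ξ * n) s) (shiftDir (ω ^ ξ * n) t ++ v)) t) +
      ulim V (fun t => blockSum ξ V n fun s v =>
        g (shiftDir (ω ^ ξ * n) t ++ s) (shiftDir (ω ^ ξ * n) t ++ v)) := by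
  have h1 := eventually_abs_block_average_le hV hg (n + 1)
  rw [blockSum, blockUltra, ulim_bind h1]
  have h2 : ∀ᶠ t in V, |average ξ (fun s => ulim (blockUltra ξ V n) fun v =>
      g (shiftDir (ω ^ ξ * n) s) (shiftDir (ω ^ ξ * n) t ++ v)) t| ≤ C :=
    hV.mono fun t ht => abs_average_le
      (fun s => abs_ulim_le (Eventually.of_forall fun v => hg _ _)) ht
  have h3 : ∀ t, ∀ᶠ v in blockUltra ξ V n, |n * average (ξ + 1) (fun s =>
      g (shiftDir (ω ^ ξ * n) t ++ s) (shiftDir (ω ^ ξ * n) t ++ v)) v| ≤ n * C :=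
    fun t => eventually_abs_block_average_le hV (fun s v => hg _ _) n
  have h4 : ∀ᶠ t in V, |blockSum ξ V n fun s v =>
      g (shiftDir (ω ^ ξ * n) t ++ s) (shiftDir (ω ^ ξ * n) t ++ v)| ≤ n * C :=
    Eventually.of_forall fun t => abs_ulim_le (h3 t)
  refine ulim_eq (((tendsto_ulim h2).add (tendsto_ulim h4)).congr' ?_)
  filter_upwards [hV] with t ht
  rw [ulim_map]
  -- For fixed `t` the average over the first block is a finite sum, so the limit over `v` passes
  -- inside it.
  refine (ulim_eq (((ulim_average (fun v s => hg _ _) t).add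
    (tendsto_ulim (h3 t))).congr' ?_)).symm
  filter_upwards [eventually_mem_blockBranch hV n] with v hv
  rw [Nat.cast_succ]
  exact (average_block (fun s => g s (shiftDir (ω ^ ξ * n) t ++ v)) ht hv).symm

end BlockSum

variable [Preorder D]

/-- `V` is an ultrafilter on the branches of `Γ_ξ D` such that each function whose averages are
above `c` in the limit is above `c` on a pruning into any prescribed member of `V`. -/
structure IsAveraging (ξ : Ordinal.{u}) (V : Ultrafilter (List (Ordinal.{u} × D))) : Prop where
  mem : ∀ᶠ t in V, t ∈ maxSet (omegaTree ξ D)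
  prunable : ∀ (g : List (Ordinal.{u} × D) → List (Ordinal.{u} × D) → ℝ) (C : ℝ),
    (∀ s t, |g s t| ≤ C) → ∀ c, c < ulim V (fun t => average ξ (fun s => g s t) t) →
    ∀ B : Set (List (Ordinal.{u} × D)), (∀ᶠ t in V, t ∈ B) →
      Prunable (omegaTree ξ D) (maxSet (omegaTree ξ D)) (omegaTree ξ D) B g c

variable [Nonempty D]

/-- If the sum of the averages over `n` blocks is so large that at least `m` of the averages must
exceed `c`, then `Γ_{ξ,m} D` can be pruned into `Γ_{ξ,n} D` with values above `c`. -/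
theorem IsAveraging.prunable_block {ξ : Ordinal.{u}} {V : Ultrafilter (List (Ordinal.{u} × D))}
    (hV : IsAveraging ξ V) {C c : ℝ} (hc : c ≤ C) (n m : ℕ)
    (g : List (Ordinal.{u} × D) → List (Ordinal.{u} × D) → ℝ) (hg : ∀ s t, |g s t| ≤ C)
    (hlt : n * c + m * (C - c) < blockSum ξ V n g)
    (B : Set (List (Ordinal.{u} × D))) (hB : ∀ᶠ t in blockUltra ξ V n, t ∈ B) :
    Prunable (blockTree ξ D m) (blockBranch ξ D m) (blockTree ξ D n) B g c := by
  induction n generalizing m g B with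
  | zero =>
    cases m with
    | zero =>
      -- For `m = 0` the source tree is empty and its only branch is `[]`, so any member of `B`
      -- completes the pruning.
      obtain ⟨b, hb⟩ := hB.exists
      exact ⟨id, fun _ => b, by simp [blockTree_zero], by simp [blockTree_zero],
        by simp [blockTree_zero], fun _ _ => hb, by simp [blockTree_zero], by simp [blockTree_zero]⟩
    | succ m =>
      have h0 : blockSum ξ V 0 g = 0 := by
        refine ulim_eq (tendsto_const_nhds.congr fun t => ?_)
        simp
      rw [h0] at hlt
      have : (0 : ℝ) ≤ ((m + 1 : ℕ) : ℝ) * (C - c) :=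
        mul_nonneg (Nat.cast_nonneg _) (sub_nonneg.2 hc)
      simp only [Nat.cast_zero, zero_mul, zero_add] at hlt
      linarith
  | succ n ih =>
    cases m with
    | zero =>
      obtain ⟨b, hb⟩ := hB.exists
      exact ⟨id, fun _ => b, by simp [blockTree_zero], by simp [blockTree_zero],
        by simp [blockTree_zero], fun _ _ => hb, by simp [blockTree_zero], by simp [blockTree_zero]⟩
    | succ m =>
      rw [blockSum_succ hV.mem hg] at hlt
      -- The values of `g` on the first block once the remaining blocks have been sent to the limit;
      -- `a` is the contribution of that block.
      set g₁ : List (Ordinal.{u} × D) → List (Ordinal.{u} × D) → ℝ := fun s t =>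
        ulim (blockUltra ξ V n) fun v =>
          g (shiftDir (ω ^ ξ * n) s) (shiftDir (ω ^ ξ * n) t ++ v) with hg₁def
      set a : ℝ := ulim V (fun t => average ξ (fun s => g₁ s t) t) with ha
      have hg₁ : ∀ s t, |g₁ s t| ≤ C := fun s t =>
        abs_ulim_le (Eventually.of_forall fun v => hg _ _)
      have haC : a ≤ C := (abs_le.1 (abs_ulim_le
        (hV.mem.mono fun t ht => abs_average_le (fun s => hg₁ s t) ht))).2
      have hrest : ∀ᶠ t in V, |blockSum ξ V n fun s v =>
          g (shiftDir (ω ^ ξ * n) t ++ s) (shiftDir (ω ^ ξ * n) t ++ v)| ≤ n * C :=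
        Eventually.of_forall fun t =>
          abs_ulim_le (eventually_abs_block_average_le hV.mem (fun s v => hg _ _) n)
      have hB' := eventually_blockUltra_succ.1 hB
      push_cast at hlt
      rcases le_or_gt a c with hac | hac
      -- The first block contributes at most `c`: it is filled with one fixed `t`, and all `m + 1`
      -- source blocks go into the remaining `n`.
      · have h1 := eventually_lt_of_lt_ulim hrest
          (c := n * c + ((m + 1 : ℕ) : ℝ) * (C - c)) (by push_cast; linarith)
        obtain ⟨t, ⟨h1, hBt⟩, ht⟩ := ((h1.and hB').and hV.mem).exists
        refine ((ih (m + 1) _ (fun s v => hg _ _) h1 _ hBt).append_target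
          (shiftDir (ω ^ ξ * n) t) (nil_notMem_blockTree _ _) (nil_notMem_blockTree _ _)).mono
            ?_ subset_rfl le_rfl
        rintro _ ⟨v, hv, rfl⟩
        exact mem_blockTree_succ.2 (Or.inr ⟨t, ht, v, hv, rfl⟩)
      -- The first block contributes more than `c` but at most `C`, so it receives a source block
      -- and enough is left for `m` others.
      · have h1 := eventually_lt_of_lt_ulim hrest (c := n * c + m * (C - c)) (by linarith)
        obtain ⟨c', hcc', hc'a⟩ := exists_between hac
        obtain ⟨θ, e, h⟩ := hV.prunable g₁ C hg₁ c' hc'a _ (hV.mem.and (h1.and hB'))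
        have h' : IsPruning (omegaTree ξ D) (maxSet (omegaTree ξ D)) (omegaTree ξ D)
            (maxSet (omegaTree ξ D)) g₁ c' θ e :=
          ⟨h.maps, h.mono, h.last, fun t ht => (h.branch t ht).1, h.pre, h.large⟩
        refine Prunable.graft h' fun t ht => ?_
        obtain ⟨-, hsum, hBt⟩ := h.branch t ht
        refine ih m _ (fun s v => hg _ _) hsum _ (hBt.and ?_)
        -- A branch has finitely many initial segments, so the strict inequalities `c < c' ≤ g₁ (θ
        -- s) (e t)` pass to `g` for almost all `v` simultaneously.
        have hfin : {s | s ∈ omegaTree ξ D ∧ s <+: t}.Finite :=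
          (List.finite_toSet t.inits).subset fun s hs => (List.mem_inits s t).2 hs.2
        have hev : ∀ᶠ v in blockUltra ξ V n, ∀ s ∈ {s | s ∈ omegaTree ξ D ∧ s <+: t},
            c ≤ g (shiftDir (ω ^ ξ * n) (θ s)) (shiftDir (ω ^ ξ * n) (e t) ++ v) := by
          refine (eventually_all_finite hfin).2 fun s hs => ?_
          refine (eventually_lt_of_lt_ulim (Eventually.of_forall fun v => hg _ _)
            (hcc'.trans_le (h.large s hs.1 t ht hs.2))).mono fun v hv => hv.le
        exact hev.mono fun v hv s hs hst => hv s ⟨hs, hst⟩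

theorem exists_isAveraging_zero [IsDirectedOrder D] :
    ∃ V : Ultrafilter (List (Ordinal.{u} × D)), IsAveraging 0 V := by
  refine ⟨(Ultrafilter.of (atTop : Filter D)).map fun U => [(0, U)], ?_, ?_⟩
  · have h : ∀ U : D, [((0 : Ordinal.{u}), U)] ∈ maxSet (omegaTree 0 D) := fun U => by
      rw [maxSet_omegaTree_zero, omegaTree_zero]
      exact ⟨U, rfl⟩
    exact eventually_map.2 (Eventually.of_forall h)
  · intro g C hg c hc B hB
    rw [ulim_map] at hc
    simp only [average_zero] at hc
    have h1 := eventually_lt_of_lt_ulim (Eventually.of_forall fun U => hg _ _) hc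
    -- The ultrafilter refines `atTop`, so each of its members meets every tail of `D`.
    have h2 : ∀ U₀ : D, ∃ U, U₀ ≤ U ∧ c < g [(0, U)] [(0, U)] ∧ [((0 : Ordinal.{u}), U)] ∈ B := by
      intro U₀
      have h3 : ∀ᶠ U in (Ultrafilter.of (atTop : Filter D) : Filter D), U₀ ≤ U :=
        Ultrafilter.of_le _ (eventually_ge_atTop U₀)
      exact (h3.and (h1.and hB)).exists
    choose φ hφ using h2
    have hmap : ∀ U, ([((0 : Ordinal.{u}), U)]).map (Prod.map id φ) = [(0, φ U)] := fun U => rfl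
    rw [maxSet_omegaTree_zero, omegaTree_zero]
    refine ⟨List.map (Prod.map id φ), List.map (Prod.map id φ), ?_, ?_, ?_, ?_, ?_, ?_⟩
    · rintro _ ⟨U, rfl⟩
      exact ⟨φ U, rfl⟩
    · rintro s - t - hst
      exact prec_map_of_prec _ hst
    · rintro _ ⟨U, rfl⟩
      simpa [LastLE] using (hφ U).1
    · rintro _ ⟨U, rfl⟩
      exact (hφ U).2.2
    · rintro s - t - hst
      exact hst.map _
    · rintro _ ⟨U, rfl⟩ _ ⟨U', rfl⟩ hst
      obtain rfl : U = U' := by simpa using hst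
      exact (hφ U).2.1.le

theorem exists_isAveraging_succ {ξ : Ordinal.{u}} {V : Ultrafilter (List (Ordinal.{u} × D))}
    (hV : IsAveraging ξ V) :
    ∃ V' : Ultrafilter (List (Ordinal.{u} × D)), IsAveraging (ξ + 1) V' := by
  have hpos : ∀ᶠ n in (hyperfilter ℕ : Filter ℕ), n ≠ 0 :=
    Nat.hyperfilter_le_atTop (eventually_ne_atTop 0)
  have hmem : ∀ᶠ n in (hyperfilter ℕ : Filter ℕ), ∀ᶠ t in blockUltra ξ V n,
      t ∈ maxSet (omegaTree (ξ + 1) D) := by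
    filter_upwards [hpos] with n hn
    exact (eventually_mem_blockBranch hV.mem n).mono fun t ht => blockBranch_subset_maxSet ξ hn ht
  refine ⟨(hyperfilter ℕ).bind (blockUltra ξ V), hmem, ?_⟩
  intro g C hg c hc B hB
  have hbd : ∀ᶠ n in (hyperfilter ℕ : Filter ℕ), ∀ᶠ t in blockUltra ξ V n,
      |average (ξ + 1) (fun s => g s t) t| ≤ C :=
    hmem.mono fun n hn => hn.mono fun t ht => abs_average_le (fun s => hg s t) ht
  rw [ulim_bind (eventually_bind.2 hbd)] at hc
  obtain ⟨c', hcc', hc'⟩ := exists_between hc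
  have hlarge := eventually_lt_of_lt_ulim (hbd.mono fun n hn => abs_ulim_le hn) hc'
  have hcC : c ≤ C := hc.le.trans
    (abs_le.1 (abs_ulim_le (hbd.mono fun n hn => abs_ulim_le hn))).2
  have key : ∀ m : ℕ, Prunable (blockTree ξ D m) (blockBranch ξ D m)
      (omegaTree (ξ + 1) D) B g c := by
    intro m
    -- With `m` fixed, the surplus `n * (c' - c)` of a long sum outgrows the cost `m * (C - c)` of
    -- securing `m` blocks.
    have hN : ∀ᶠ n : ℕ in (hyperfilter ℕ : Filter ℕ), m * (C - c) < n * (c' - c) :=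
      Nat.hyperfilter_le_atTop ((tendsto_natCast_atTop_atTop.atTop_mul_const
        (sub_pos.2 hcc')).eventually_gt_atTop _)
    obtain ⟨n, ⟨⟨h1, h2⟩, h3⟩, h4, h5⟩ :=
      (((hlarge.and hN).and (eventually_bind.1 hB)).and (hbd.and hpos)).exists
    refine (hV.prunable_block hcC n m g hg ?_ B h3).mono (blockTree_subset ξ n) subset_rfl le_rfl
    have h6 : blockSum ξ V n g =
        n * ulim (blockUltra ξ V n) (fun t => average (ξ + 1) (fun s => g s t) t) :=
      ulim_eq ((tendsto_ulim h4).const_mul _)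
    have h7 : (0 : ℝ) ≤ n := Nat.cast_nonneg n
    rw [h6]
    nlinarith
  have htree : omegaTree (ξ + 1) D = ⋃ n, blockTree ξ D (n + 1) := by
    rw [omegaTree_succ]
    ext s
    simp only [Set.mem_iUnion]
    refine ⟨?_, fun ⟨n, hn⟩ => ⟨n + 1, hn⟩⟩
    rintro ⟨n, hn⟩
    cases n with
    | zero => simp [blockTree_zero] at hn
    | succ n => exact ⟨n, hn⟩
  rw [maxSet_omegaTree_succ (maxSet_omegaTree_nonempty ξ)]
  have := Prunable.iUnion (S := fun n => blockTree ξ D (n + 1))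
    (M := fun n => blockBranch ξ D (n + 1)) (fun i j s t hs ht h => by
      simpa using blockTree_index_eq hs ht h) blockBranch_succ_subset fun n => key (n + 1)
  rwa [← htree] at this

theorem exists_isAveraging_limit {ξ : Ordinal.{u}} (hξ : IsSuccLimit ξ)
    (h : ∀ ζ < ξ, ∃ V : Ultrafilter (List (Ordinal.{u} × D)), IsAveraging ζ V) :
    ∃ V : Ultrafilter (List (Ordinal.{u} × D)), IsAveraging ξ V := by
  have hex : ∀ ζ : Set.Iio ξ, ∃ V : Ultrafilter (List (Ordinal.{u} × D)),
      IsAveraging (ζ.1 + 1) V := fun ζ => h _ (hξ.add_one_lt ζ.2)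
  choose V hV using hex
  have hne : Nonempty (Set.Iio ξ) := ⟨⟨0, hξ.bot_lt⟩⟩
  let W : Ultrafilter (Set.Iio ξ) := Ultrafilter.of atTop
  have hW : ∀ ζ : Set.Iio ξ, ∀ᶠ η in W, ζ ≤ η := fun ζ =>
    Ultrafilter.of_le _ (eventually_ge_atTop ζ)
  have hsub : ∀ ζ : Set.Iio ξ, shiftDir (ω ^ ζ.1) '' omegaTree (ζ.1 + 1) D ⊆ omegaTree ξ D := by
    intro ζ
    rw [omegaTree_limit hξ]
    exact Set.subset_iUnion (fun η : Set.Iio ξ => shiftDir (ω ^ η.1) '' omegaTree (η.1 + 1) D) ζ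
  have hmem : ∀ ζ, ∀ᶠ t in V ζ, shiftDir (ω ^ ζ.1) t ∈ maxSet (omegaTree ξ D) := by
    intro ζ
    filter_upwards [(hV ζ).mem] with t ht
    rw [maxSet_omegaTree_limit hξ]
    exact Set.mem_iUnion.2 ⟨ζ, t, ht, rfl⟩
  refine ⟨W.bind fun ζ => (V ζ).map (shiftDir (ω ^ ζ.1)), eventually_bind.2 (Eventually.of_forall hmem), ?_⟩
  intro g C hg c hc B hB
  have hbd : ∀ ζ, ∀ᶠ t in (V ζ).map (shiftDir (ω ^ ζ.1)), |average ξ (fun s => g s t) t| ≤ C :=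
    fun ζ => (hmem ζ).mono fun t ht => abs_average_le (fun s => hg s _) ht
  rw [ulim_bind (eventually_bind.2 (Eventually.of_forall hbd))] at hc
  have hlarge := eventually_lt_of_lt_ulim
    (Eventually.of_forall fun ζ => abs_ulim_le (hbd ζ)) hc
  rw [maxSet_omegaTree_limit hξ]
  have key : ∀ ζ : Set.Iio ξ, Prunable (shiftDir (ω ^ ζ.1) '' omegaTree (ζ.1 + 1) D)
      (shiftDir (ω ^ ζ.1) '' maxSet (omegaTree (ζ.1 + 1) D)) (omegaTree ξ D) B g c := by
    intro ζ
    -- The piece at `ζ` itself may have small averages; some `η ≥ ζ` has large ones, and `Γ_{ζ+1}`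
    -- is pruned into `Γ_{η+1}`.
    obtain ⟨η, ⟨h1, h2⟩, h3⟩ := ((hlarge.and (hW ζ)).and (eventually_bind.1 hB)).exists
    rw [ulim_map] at h1
    have h4 : ulim (V η) (fun t => average ξ (fun s => g s (shiftDir (ω ^ η.1) t))
        (shiftDir (ω ^ η.1) t)) = ulim (V η) (fun t => average (η.1 + 1)
          (fun s => g (shiftDir (ω ^ η.1) s) (shiftDir (ω ^ η.1) t)) t) :=
      ulim_congr ((hV η).mem.mono fun t ht => abs_average_le (fun s => hg _ _) ht)
        ((hV η).mem.mono fun t ht => average_limit hξ η.2 _ ht.1)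
    rw [h4] at h1
    have h5 := (hV η).prunable _ C (fun s t => hg _ _) c h1 _ h3
    have h6 : ζ.1 + 1 ≤ η.1 + 1 := add_le_add_left (Subtype.coe_le_coe.2 h2) 1
    exact ((((prunable_omegaTree_of_le h6).trans h5 (nil_notMem_omegaTree _)).shift_target).mono
      (hsub η) subset_rfl le_rfl).shift_source _
  have := Prunable.iUnion shift_index_eq
    (fun ζ : Set.Iio ξ => Set.image_mono fun t (ht : t ∈ maxSet (omegaTree (ζ.1 + 1) D)) => ht.1) key
  rwa [← omegaTree_limit hξ] at this

theorem exists_isAveraging [IsDirectedOrder D] (ξ : Ordinal.{u}) :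
    ∃ V : Ultrafilter (List (Ordinal.{u} × D)), IsAveraging ξ V := by
  induction ξ using Ordinal.limitRecOn with
  | zero => exact exists_isAveraging_zero
  | add_one ξ ih => exact exists_isAveraging_succ ih.choose_spec
  | limit ξ hξ ih => exact exists_isAveraging_limit hξ ih

end Averaging

/-! ### From averages to large functions -/

section Large

variable {D : Type v}

theorem getLast?_map_snd_concat {Λ : Type*} (s : List (Λ × D)) (x : Λ × D) :
    ((s ++ [x]).map Prod.snd).getLast? = some x.2 := by
  simp

theorem isLarge_of_prunable [Preorder D] {ξ : Ordinal.{u}} {ε : ℝ}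
    {f : piSet (omegaTree ξ D) → ℝ} {g : List (Ordinal.{u} × D) → List (Ordinal.{u} × D) → ℝ}
    (hg : ∀ p : piSet (omegaTree ξ D), g p.1.1 p.1.2 = f p)
    (h : Prunable (omegaTree ξ D) (maxSet (omegaTree ξ D)) (omegaTree ξ D)
      (maxSet (omegaTree ξ D)) g ε) : IsLarge ε f := by
  obtain ⟨θ, e, h⟩ := h
  intro δ hδ
  refine ⟨⟨fun s => ⟨θ s.1, h.maps s.1 s.2⟩, fun t => ⟨e t.1, h.branch t.1 t.2⟩,
    fun s t hst => h.mono s.1 s.2 t.1 t.2 hst, ?_,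
    fun t => h.pre t.1 t.2.1 t.1 t.2 List.prefix_rfl⟩, fun p => ?_⟩
  · intro s s₁ ζ U s₂ ζ' U' hs hs'
    refine h.last s.1 s.2 U ?_ U' ?_
    · rw [hs]
      exact getLast?_map_snd_concat s₁ (ζ, U)
    · rw [show θ s.1 = s₂ ++ [(ζ', U')] from hs']
      exact getLast?_map_snd_concat s₂ (ζ', U')
  · have h1 := h.large p.1.1 p.2.1 p.1.2 p.2.2.1 p.2.2.2
    rw [← hg]
    exact (sub_le_self ε hδ.le).trans h1

/-- Members of `Γ_ξ` are nonempty sequences, so `Ω_ξ` is empty and all conditions are vacuous. -/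
theorem isLarge_of_isEmpty [LE D] [IsEmpty D] {ξ : Ordinal.{u}} (ε : ℝ)
    (f : piSet (omegaTree ξ D) → ℝ) : IsLarge ε f := by
  have hemp : ∀ s : List (Ordinal.{u} × D), s ∉ omegaTree ξ D := by
    intro s hs
    cases s with
    | nil => exact omegaTree_ne_nil hs rfl
    | cons x s => exact isEmptyElim x.2
  intro δ _
  exact ⟨⟨fun s => absurd s.2 (hemp _), fun t => absurd t.2.1 (hemp _),
    fun s => absurd s.2 (hemp _), fun s => absurd s.2 (hemp _), fun t => absurd t.2.1 (hemp _)⟩,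
    fun p => absurd p.2.1 (hemp _)⟩

/-- If along each branch one of finitely many bounded functions has an average above its
threshold, with a uniform gap, then one of these functions is large. -/
theorem exists_isLarge [Preorder D] [IsDirectedOrder D] [Nonempty D] {ξ : Ordinal.{u}} {ι : Type*}
    [Finite ι] (f : ι → piSet (omegaTree ξ D) → ℝ) (hf : ∀ i, ∃ C : ℝ, ∀ p, |f i p| ≤ C)
    (ε : ι → ℝ) {m : ℝ} (hm : 0 < m) (h : ∀ t, ∃ i, m ≤ branchAverage (f i) t - ε i) :
    ∃ i, IsLarge (ε i) (f i) := by
  classical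
  obtain ⟨V, hV⟩ := exists_isAveraging (D := D) ξ
  let g : ι → List (Ordinal.{u} × D) → List (Ordinal.{u} × D) → ℝ := fun i s t =>
    if h : (s, t) ∈ piSet (omegaTree ξ D) then f i ⟨_, h⟩ else 0
  have hev : ∀ᶠ t in V, ∃ i, m ≤ average ξ (fun s => g i s t) t - ε i := by
    filter_upwards [hV.mem] with t ht
    obtain ⟨i, hi⟩ := h ⟨t, ht⟩
    exact ⟨i, by rwa [branchAverage_eq_average] at hi⟩
  -- The index depends on the branch, but an ultrafilter settles on one of finitely many.
  obtain ⟨i, hi⟩ := Ultrafilter.eventually_exists_iff.1 hev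
  obtain ⟨C, hC⟩ := hf i
  have hg : ∀ s t, |g i s t| ≤ max C 0 := by
    intro s t
    by_cases hst : (s, t) ∈ piSet (omegaTree ξ D)
    · simp only [g, dif_pos hst]
      exact (hC _).trans (le_max_left _ _)
    · simp [g, dif_neg hst]
  have hlim : ε i + m ≤ ulim V (fun t => average ξ (fun s => g i s t) t) :=
    le_ulim (hV.mem.mono fun t ht => abs_average_le (fun s => hg s t) ht)
      (hi.mono fun t ht => by linarith)
  refine ⟨i, isLarge_of_prunable (g := g i) (fun p => ?_)
    (hV.prunable (g i) _ hg (ε i) (by linarith) _ hV.mem)⟩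
  simp only [g, dif_pos p.2]

theorem abs_branchAverage_le [Nonempty D] {ξ : Ordinal.{u}} {f : piSet (omegaTree ξ D) → ℝ} {C : ℝ}
    (hf : ∀ p, |f p| ≤ C) (t : maxSet (omegaTree ξ D)) : |branchAverage f t| ≤ max C 0 := by
  classical
  rw [branchAverage_eq_average]
  refine abs_average_le (fun s => ?_) t.2
  split_ifs with h
  · exact (hf _).trans (le_max_left _ _)
  · simp

end Large

end BTree

theorem mainTheorem5 {D : Type v} [Preorder D] [IsDirectedOrder D] (ξ : Ordinal.{u}) (n : ℕ)
    (hn : 0 < n) (F : Fin n → Set (BTree.piSet (BTree.omegaTree ξ D) → ℝ)) (ε : Fin n → ℝ)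
    (hbdd : ∀ i, ∀ f ∈ F i, ∃ C : ℝ, ∀ p, |f p| ≤ C)
    (hF : ∀ i, ∀ f ∈ F i, ¬ BTree.IsLarge (ε i) f)
    (f : Fin n → BTree.piSet (BTree.omegaTree ξ D) → ℝ) (hf : ∀ i, f i ∈ F i) :
    ∃ m : ℝ,
      IsGLB (Set.range fun t : BTree.maxSet (BTree.omegaTree ξ D) =>
        (Finset.univ : Finset (Fin n)).sup' ⟨⟨0, hn⟩, Finset.mem_univ _⟩
          fun i => BTree.branchAverage (f i) t - ε i) m ∧
      m ≤ 0 := by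
  rcases isEmpty_or_nonempty D with hD | hD
  -- For empty `D` every function is large, against the hypothesis on `F`.
  · exact absurd (BTree.isLarge_of_isEmpty _ _) (hF ⟨0, hn⟩ _ (hf _))
  have hne : (Set.range fun t : BTree.maxSet (BTree.omegaTree ξ D) =>
      (Finset.univ : Finset (Fin n)).sup' ⟨⟨0, hn⟩, Finset.mem_univ _⟩
        fun i => BTree.branchAverage (f i) t - ε i).Nonempty :=
    ⟨_, ⟨_, (BTree.maxSet_omegaTree_nonempty ξ).some_mem⟩, rfl⟩
  have hbelow : BddBelow (Set.range fun t : BTree.maxSet (BTree.omegaTree ξ D) =>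
      (Finset.univ : Finset (Fin n)).sup' ⟨⟨0, hn⟩, Finset.mem_univ _⟩
        fun i => BTree.branchAverage (f i) t - ε i) := by
    obtain ⟨C, hC⟩ := hbdd ⟨0, hn⟩ _ (hf _)
    refine ⟨-max C 0 - ε ⟨0, hn⟩, ?_⟩
    rintro _ ⟨t, rfl⟩
    refine le_trans ?_ (Finset.le_sup' (fun i => BTree.branchAverage (f i) t - ε i)
      (Finset.mem_univ (⟨0, hn⟩ : Fin n)))
    exact sub_le_sub_right (abs_le.1 (BTree.abs_branchAverage_le hC t)).1 _
  refine ⟨_, isGLB_csInf hne hbelow, ?_⟩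
  -- A positive infimum is the uniform gap required by `BTree.exists_isLarge`.
  by_contra! hm
  obtain ⟨i, hi⟩ := BTree.exists_isLarge f (fun i => hbdd i _ (hf i)) ε hm fun t => by
    obtain ⟨i, -, hi⟩ := (Finset.le_sup'_iff _).1 (csInf_le hbelow ⟨t, rfl⟩)
    exact ⟨i, hi⟩
  exact hF i _ (hf i) hi
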